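/- **Theorem (truncation error).** Let $0<\beta<2$ and $\beta<\gamma\le 2$. For $\lambda\ge 0$ let $c_{\beta,\lambda}=\frac{1}{2\pi|\Gamma(-\beta)|}$ if $\lambda>0$ and $\beta\neq 1$, and $c_{\beta,\lambda}=\frac{\beta\,\Gamma(1+\beta/2)}{2^{1-\beta}\pi\,\Gamma(1-\beta/2)}$ if $\lambda=0$ or $\beta=1$, and define $$(\Delta+\lambda)^{\beta/2}u(x,y)=c_{\beta,\lambda}\,\mathrm{P.V.}\!\iint_{\mathbb R^2}\frac{u(x+\xi,y+\eta)-u(x,y)}{e^{\lambda r}r^{2+\beta}}\,d\xi\,d\eta,\qquad r=\sqrt{\xi^2+\eta^2}.$$ *The discrete operator.* Let $l>0$, $\Omega=(-l,l)^2$, $L=2l$, $N\ge1$ an integer, $h=L/N$, $\xi_i=ih$, $\eta_j=jh$. For $(x,y)\in\Omega$ put $$g(\xi,\eta)=u(x+\xi,y+\eta)+u(x-\xi,y+\eta)+u(x-\xi,y-\eta)+u(x+\xi,y-\eta)-4u(x,y),\qquad \phi_\gamma(\xi,\eta)=\frac{g(\xi,\eta)}{e^{\lambda r}r^{\gamma}}.$$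 Let $\Omega_{i,j}=[\xi_i,\xi_{i+1}]\times[\eta_j,\eta_{j+1}]$, let $k_\gamma=1$ for $\gamma<2$ and $k_2=\frac43$, and let $\Pi_{i,j}\phi_\gamma$ be the bilinear interpolant of $\phi_\gamma$ at the four corners of $\Omega_{i,j}$. Define $$G_{0,0}=\iint_{\Omega_{0,0}}r^{\gamma-2-\beta}\,d\xi\,d\eta,\qquad I_{i,j}=\iint_{\Omega_{i,j}}\Pi_{i,j}\phi_\gamma\; r^{\gamma-2-\beta}\,d\xi\,d\eta,\qquad G^\infty=\iint_{[0,\infty)^2\setminus[0,L]^2}\frac{d\xi\,d\eta}{e^{\lambda r}r^{2+\beta}},$$ $$(\Delta+\lambda)_h^{\beta/2}u(x,y)=c_{\beta,\lambda}\Big(\tfrac{k_\gamma}{4}\big(\phi_\gamma(0,h)+\phi_\gamma(h,h)+\phi_\gamma(h,0)\big)G_{0,0}+\sum_{\substack{0\le i,j\le N-1\\(i,j)\ne(0,0)}}I_{i,j}-4u(x,y)\,G^\infty\Big).$$ *Claim.* Let $u\in C^2(\mathbb R^2)$ be real-valued. There is a constant $C>0$, depending only on $\beta$, $\gamma$ and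 $u$, such that for every $l>0$ for which $u$ vanishes outside $\Omega=(-l,l)^2$ and every $\lambda\ge0$: the principal value defining $(\Delta+\lambda)^{\beta/2}u$ exists at every point of $\Omega$, and for every integer $N\ge1$, with $h=2l/N$, $$\sup_{(x,y)\in\Omega}\Big|(\Delta+\lambda)^{\beta/2}u(x,y)-(\Delta+\lambda)^{\beta/2}_hu(x,y)\Big|\le C\,h^{2-\beta}.$$ -/

import Mathlib

open MeasureTheory Filter Topology

noncomputable section

namespace TemperedFrac

/-- The open square `(-l,l) × (-l,l)`. -/
def square (l : ℝ) : Set (ℝ × ℝ) := Set.Ioo (-l) l ×ˢ Set.Ioo (-l) l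

/-- Euclidean length `√(ξ² + η²)` (the built-in norm of `ℝ × ℝ` is the sup norm). -/
def rad (q : ℝ × ℝ) : ℝ := Real.sqrt (q.1 ^ 2 + q.2 ^ 2)

/-- The kernel `1 / (e^{λ r} r^{2+β})`, `r = √(ξ² + η²)`. -/
def kernel (β lam : ℝ) (q : ℝ × ℝ) : ℝ :=
  1 / (Real.exp (lam * rad q) * rad q ^ (2 + β))

/-- The normalising constant in dimension two.  For `λ > 0` and `β ≠ 1` it is
`Γ(1) / (2 π |Γ(-β)|)`; for `λ = 0` it is the constant of the fractional Laplacian.  The first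
formula has a pole of `Γ` in the denominator at `β = 1`, and the second one is used there too. -/
def normConst (β lam : ℝ) : ℝ :=
  if lam = 0 ∨ β = 1 then
    β * Real.Gamma ((2 + β) / 2) / (2 ^ (1 - β) * Real.pi * Real.Gamma (1 - β / 2))
  else
    Real.Gamma 1 / (2 * Real.pi * |Real.Gamma (-β)|)

/-- The integrand `(u(p + q) - u(p)) / (e^{λ|q|} |q|^{2+β})`. -/
def pvIntegrand (β lam : ℝ) (u : ℝ × ℝ → ℝ) (p q : ℝ × ℝ) : ℝ :=
  (u (p + q) - u p) * kernel β lam q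

/-- The integral over the complement of the closed Euclidean disc of radius `ε`. -/
def pvTrunc (β lam : ℝ) (u : ℝ × ℝ → ℝ) (p : ℝ × ℝ) (ε : ℝ) : ℝ :=
  ∫ q in {q : ℝ × ℝ | ε < rad q}, pvIntegrand β lam u p q

/-- The principal value integral at `p` exists: all truncated integrals converge absolutely, and
they have a finite limit as `ε → 0+`. -/
def PVExists (β lam : ℝ) (u : ℝ × ℝ → ℝ) (p : ℝ × ℝ) : Prop :=
  (∀ ε : ℝ, 0 < ε → IntegrableOn (pvIntegrand β lam u p) {q : ℝ × ℝ | ε < rad q}) ∧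
    ∃ I : ℝ, Tendsto (pvTrunc β lam u p) (𝓝[>] 0) (𝓝 I)

/-- The tempered fractional Laplacian `(Δ + λ)^{β/2} u (p)`: the normalising constant times the
principal value integral (meaningful where `PVExists` holds). -/
def temperedFracLap (β lam : ℝ) (u : ℝ × ℝ → ℝ) (p : ℝ × ℝ) : ℝ :=
  normConst β lam * limUnder (𝓝[>] (0 : ℝ)) (pvTrunc β lam u p)

/-- The symmetrised difference `g(x,y,ξ,η)`. -/
def symDiff4 (u : ℝ × ℝ → ℝ) (p : ℝ × ℝ) (ξ η : ℝ) : ℝ :=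
  u (p.1 + ξ, p.2 + η) + u (p.1 - ξ, p.2 + η) + u (p.1 - ξ, p.2 - η) + u (p.1 + ξ, p.2 - η)
    - 4 * u p

/-- `φ_γ(ξ,η) = g(x,y,ξ,η) / (e^{λ r} r^γ)` with `r = √(ξ² + η²)` and `p = (x,y)`. -/
def phi (γ lam : ℝ) (u : ℝ × ℝ → ℝ) (p : ℝ × ℝ) (ξ η : ℝ) : ℝ :=
  symDiff4 u p ξ η / (Real.exp (lam * rad (ξ, η)) * rad (ξ, η) ^ γ)

/-- The weight `(ξ² + η²)^{(γ-2-β)/2}`. -/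
def weight (β γ : ℝ) (q : ℝ × ℝ) : ℝ := (q.1 ^ 2 + q.2 ^ 2) ^ ((γ - 2 - β) / 2)

/-- The grid cell `[ih,(i+1)h] × [jh,(j+1)h]`. -/
def cell (h : ℝ) (i j : ℕ) : Set (ℝ × ℝ) :=
  Set.Icc (i * h) ((i + 1) * h) ×ˢ Set.Icc (j * h) ((j + 1) * h)

/-- `G_{0,0}`, the integral of the weight over the singular cell. -/
def Gzero (β γ h : ℝ) : ℝ := ∫ q in cell h 0 0, weight β γ q

/-- `G_{i,j}`. -/
def G (β γ h : ℝ) (i j : ℕ) : ℝ := (1 / h ^ 2) * ∫ q in cell h i j, weight β γ q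

/-- `G^ξ_{i,j}`. -/
def Gxi (β γ h : ℝ) (i j : ℕ) : ℝ := (1 / h ^ 2) * ∫ q in cell h i j, q.1 * weight β γ q

/-- `G^η_{i,j}`. -/
def Geta (β γ h : ℝ) (i j : ℕ) : ℝ := (1 / h ^ 2) * ∫ q in cell h i j, q.2 * weight β γ q

/-- `G^{ξη}_{i,j}`. -/
def Gxieta (β γ h : ℝ) (i j : ℕ) : ℝ :=
  (1 / h ^ 2) * ∫ q in cell h i j, q.1 * q.2 * weight β γ q

/-- `I_{i,j}`: the integral over the cell of the weight times the bilinear interpolant at the four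
corners, of the function `f` on the first quadrant. -/
def interpCell (β γ h : ℝ) (f : ℝ → ℝ → ℝ) (i j : ℕ) : ℝ :=
  let x₀ : ℝ := i * h
  let x₁ : ℝ := (i + 1) * h
  let y₀ : ℝ := j * h
  let y₁ : ℝ := (j + 1) * h
  f x₀ y₀ * (Gxieta β γ h i j - x₁ * Geta β γ h i j - y₁ * Gxi β γ h i j + x₁ * y₁ * G β γ h i j)
    - f x₁ y₀ *
      (Gxieta β γ h i j - x₀ * Geta β γ h i j - y₁ * Gxi β γ h i j + x₀ * y₁ * G β γ h i j)
    - f x₀ y₁ *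
      (Gxieta β γ h i j - x₁ * Geta β γ h i j - y₀ * Gxi β γ h i j + x₁ * y₀ * G β γ h i j)
    + f x₁ y₁ *
      (Gxieta β γ h i j - x₀ * Geta β γ h i j - y₀ * Gxi β γ h i j + x₀ * y₀ * G β γ h i j)

/-- `k_γ = 1` for `γ < 2` and `k_2 = 4/3`. -/
def kGamma (γ : ℝ) : ℝ := if γ = 2 then 4 / 3 else 1

/-- The weighted trapezoidal rule on the singular cell. -/
def singularCell (β γ h : ℝ) (f : ℝ → ℝ → ℝ) : ℝ :=
  kGamma γ / 4 * (f 0 h + f h h + f h 0) * Gzero β γ h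

/-- `G^∞`: the integral of the kernel over the first quadrant outside `[0,L] × [0,L]`. -/
def Ginf (β lam L : ℝ) : ℝ :=
  (∫ q in Set.Ioc 0 L ×ˢ Set.Ioi L, kernel β lam q)
    + (∫ q in Set.Ioi L ×ˢ Set.Ioc 0 L, kernel β lam q)
    + ∫ q in Set.Ioi L ×ˢ Set.Ioi L, kernel β lam q

/-- The finite difference operator `(Δ + λ)_h^{β/2} u (p)` on `(-l,l)²`, with `L = 2l` and mesh
size `h = L / N`. -/
def discreteTFL (β γ lam l : ℝ) (N : ℕ) (u : ℝ × ℝ → ℝ) (p : ℝ × ℝ) : ℝ :=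
  normConst β lam *
    (singularCell β γ (2 * l / N) (phi γ lam u p)
      + ∑ ij ∈ (Finset.range N ×ˢ Finset.range N).erase (0, 0),
          interpCell β γ (2 * l / N) (phi γ lam u p) ij.1 ij.2
      - 4 * u p * Ginf β lam (2 * l))

end TemperedFrac

end

noncomputable section

namespace TemperedFrac

/-! ### One-dimensional calculus -/

/-! The kernel is invariant under both coordinate reflections, so averaging over them replaces `u (p
+ q) - u p` by a quarter of the symmetrised difference `g`. Evenness of `g` gives `|g| ≤ 4 M r²`,
with `M` a bound for the two pure second partials of `u` (`abs_symDiff4_le`). The symmetrised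
integrand is therefore absolutely integrable, and the principal value is its integral over the first
quadrant (`tendsto_pvTrunc`).

That quadrant splits into three regions. Outside `[0,L]²` all four shifted points leave the support,
so `g = -4 u p` and the `G^∞` term is exact (`setIntegral_outer_eq`). On the singular cell the
integral and its quadrature are each `O(h^(2-β))`, so no cancellation between them is needed
(`abs_setIntegral_singularCell_le`, `abs_singularCell_le`). On every other cell the pure second
partials of `φ_γ` are `O(r^(-γ))`; the bilinear interpolation error times the weight is then `O(h²
r^(-2-β))`, and integrating over `‖q‖ > h` gives `h² · h^(-β)` (`abs_phi_sub_bilin_le`,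
`sum_setIntegral_norm_rpow_le`).

Uniformity in `λ` comes from `λ^k e^(-λr) ≤ C r^(-k)` for `k = 1, 2`. Uniformity in `l` and `N`
holds because the cell sum is dominated by an integral over the whole exterior `‖q‖ > h`. -/

/-- The mean value theorem from `t` to each endpoint turns the error into `(b-t)(t-a)/(b-a)` times a
difference of two values of `f'`, which the bound on `f''` controls. The constant is not sharp, but
`f''` need not be continuous. -/
theorem abs_sub_linearInterp_le {f f' f'' : ℝ → ℝ} {a b M t : ℝ} (hab : a < b)
    (hf : ∀ x ∈ Set.Icc a b, HasDerivAt f (f' x) x)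
    (hf' : ∀ x ∈ Set.Icc a b, HasDerivAt f' (f'' x) x)
    (hM : ∀ x ∈ Set.Icc a b, |f'' x| ≤ M) (ht : t ∈ Set.Icc a b) :
    |f t - ((b - t) * f a + (t - a) * f b) / (b - a)| ≤ M * (b - a) ^ 2 := by
  have hM0 : 0 ≤ M := (abs_nonneg _).trans (hM t ht)
  have mvt : ∀ s ∈ Set.Icc a b, ∃ c ∈ Set.Icc a b, f s - f t = f' c * (s - t) := by
    intro s hs
    have hsub : ∀ p ∈ Set.Icc a b, ∀ q ∈ Set.Icc a b, p < q →
        ∃ c ∈ Set.Icc a b, f q - f p = f' c * (q - p) := by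
      intro p hp q hq hpq
      have hin : Set.Icc p q ⊆ Set.Icc a b := Set.Icc_subset_Icc hp.1 hq.2
      obtain ⟨c, hc, hce⟩ := exists_hasDerivAt_eq_slope f f' hpq
        (fun x hx => (hf x (hin hx)).continuousAt.continuousWithinAt)
        (fun x hx => hf x (hin (Set.Ioo_subset_Icc_self hx)))
      refine ⟨c, hin (Set.Ioo_subset_Icc_self hc), ?_⟩
      rw [hce]
      have : q - p ≠ 0 := by linarith
      field_simp
    rcases lt_trichotomy s t with h | h | h
    · obtain ⟨c, hc, e⟩ := hsub s hs t ht h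
      exact ⟨c, hc, by linarith⟩
    · exact ⟨t, ht, by simp [h]⟩
    · exact hsub t ht s hs h
  obtain ⟨c, hc, hce⟩ := mvt a (Set.left_mem_Icc.2 hab.le)
  obtain ⟨d, hd, hde⟩ := mvt b (Set.right_mem_Icc.2 hab.le)
  have hcd : |f' d - f' c| ≤ M * (b - a) := by
    have h1 := (convex_Icc a b).norm_image_sub_le_of_norm_hasDerivWithin_le
      (fun x hx => (hf' x hx).hasDerivWithinAt) (fun x hx => hM x hx) hc hd
    refine h1.trans (mul_le_mul_of_nonneg_left ?_ hM0)
    exact abs_sub_le_iff.2 ⟨by linarith [hd.2, hc.1], by linarith [hd.1, hc.2]⟩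
  have hba : 0 < b - a := by linarith
  have e : f t - ((b - t) * f a + (t - a) * f b) / (b - a)
      = -((b - t) * (t - a) / (b - a) * (f' d - f' c)) := by
    have e1 : f a = f t + f' c * (a - t) := by linarith
    have e2 : f b = f t + f' d * (b - t) := by linarith
    rw [e1, e2]
    field_simp
    ring
  have h0 : 0 ≤ (b - t) * (t - a) := mul_nonneg (by linarith [ht.2]) (by linarith [ht.1])
  have h2 : (b - t) * (t - a) / (b - a) ≤ b - a := by
    rw [div_le_iff₀ hba]
    exact mul_le_mul (by linarith [ht.1]) (by linarith [ht.2]) (by linarith [ht.1]) hba.le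
  rw [e, abs_neg, abs_mul, abs_of_nonneg (div_nonneg h0 hba.le)]
  calc _ ≤ (b - a) * (M * (b - a)) := mul_le_mul h2 hcd (abs_nonneg _) hba.le
    _ = _ := by ring

/-! ### The tempered radial powers `e^{-λ r} r^{-a}` -/

theorem rad_nonneg (q : ℝ × ℝ) : 0 ≤ rad q := Real.sqrt_nonneg _

theorem rad_sq (q : ℝ × ℝ) : rad q ^ 2 = q.1 ^ 2 + q.2 ^ 2 := Real.sq_sqrt (by positivity)

theorem abs_fst_le_rad (q : ℝ × ℝ) : |q.1| ≤ rad q :=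
  Real.abs_le_sqrt (by nlinarith [sq_nonneg q.2])

theorem abs_snd_le_rad (q : ℝ × ℝ) : |q.2| ≤ rad q :=
  Real.abs_le_sqrt (by nlinarith [sq_nonneg q.1])

theorem continuous_rad : Continuous rad := by
  unfold rad; fun_prop

/-- Radial integrals are computed below in the sup norm; this and the reverse comparison carry
Euclidean bounds over to it. -/
theorem norm_le_rad (q : ℝ × ℝ) : ‖q‖ ≤ rad q := by
  rw [Prod.norm_def]
  exact max_le (abs_fst_le_rad q) (abs_snd_le_rad q)

theorem rad_le_two_mul_norm (q : ℝ × ℝ) : rad q ≤ 2 * ‖q‖ := by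
  have h1 : |q.1| ≤ ‖q‖ := norm_fst_le q
  have h2 : |q.2| ≤ ‖q‖ := norm_snd_le q
  refine Real.sqrt_le_iff.2 ⟨by positivity, ?_⟩
  nlinarith [sq_le_sq' (abs_le.1 h1).1 (abs_le.1 h1).2, sq_le_sq' (abs_le.1 h2).1 (abs_le.1 h2).2,
    sq_nonneg ‖q‖]

/-- The radial profile `e^{-λ r} r^{-a}`. -/
def temperedPow (lam a r : ℝ) : ℝ := Real.exp (-(lam * r)) * r ^ (-a)

theorem temperedPow_nonneg (lam a : ℝ) {r : ℝ} (hr : 0 ≤ r) : 0 ≤ temperedPow lam a r :=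
  mul_nonneg (Real.exp_pos _).le (Real.rpow_nonneg hr _)

theorem temperedPow_le {lam r : ℝ} (a : ℝ) (hl : 0 ≤ lam) (hr : 0 ≤ r) :
    temperedPow lam a r ≤ r ^ (-a) :=
  mul_le_of_le_one_left (Real.rpow_nonneg hr _)
    (Real.exp_le_one_iff.2 (by nlinarith [mul_nonneg hl hr]))

theorem mul_exp_neg_le_one {x : ℝ} : x * Real.exp (-x) ≤ 1 := by
  rw [Real.exp_neg, ← div_eq_mul_inv, div_le_one (Real.exp_pos _)]
  linarith [Real.add_one_le_exp x]

theorem sq_mul_exp_neg_le_two {x : ℝ} (hx : 0 ≤ x) : x ^ 2 * Real.exp (-x) ≤ 2 := by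
  rw [Real.exp_neg, ← div_eq_mul_inv, div_le_iff₀ (Real.exp_pos _)]
  linarith [Real.quadratic_le_exp_of_nonneg hx]

/-- A factor `λ` is traded for a factor `1/r`, because `λr e^(-λr) ≤ 1`. This trade, and its square
below, remove `λ` from all derivative bounds. -/
theorem mul_temperedPow_le (lam a : ℝ) {r : ℝ} (hr : 0 < r) :
    lam * temperedPow lam a r ≤ r ^ (-(a + 1)) := by
  have e : r ^ (-a) = r * r ^ (-(a + 1)) := by
    rw [mul_comm, ← Real.rpow_add_one hr.ne']; ring_nf
  unfold temperedPow
  rw [e]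
  calc _ = (lam * r) * Real.exp (-(lam * r)) * r ^ (-(a + 1)) := by ring
    _ ≤ _ := mul_le_of_le_one_left (Real.rpow_nonneg hr.le _) mul_exp_neg_le_one

theorem sq_mul_temperedPow_le {lam r : ℝ} (a : ℝ) (hl : 0 ≤ lam) (hr : 0 < r) :
    lam ^ 2 * temperedPow lam a r ≤ 2 * r ^ (-(a + 2)) := by
  have e : r ^ (-a) = r ^ 2 * r ^ (-(a + 2)) := by
    rw [mul_comm, ← Real.rpow_natCast, ← Real.rpow_add hr]; norm_num
  unfold temperedPow
  rw [e]
  calc _ = ((lam * r) ^ 2 * Real.exp (-(lam * r))) * r ^ (-(a + 2)) := by ring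
    _ ≤ _ := mul_le_mul_of_nonneg_right (sq_mul_exp_neg_le_two (by positivity))
      (Real.rpow_nonneg hr.le _)

theorem hasDerivAt_rad {ξ η : ℝ} (h : 0 < rad (ξ, η)) :
    HasDerivAt (fun t => rad (t, η)) (ξ / rad (ξ, η)) ξ := by
  have h0 : ξ ^ 2 + η ^ 2 ≠ 0 := by
    have := rad_sq (ξ, η)
    simp only at this
    rw [← this]; positivity
  have h1 : HasDerivAt (fun t : ℝ => t ^ 2 + η ^ 2) (2 * ξ) ξ := by
    simpa using (hasDerivAt_pow 2 ξ).add_const (η ^ 2)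
  convert h1.sqrt h0 using 1
  unfold rad
  simp only
  rw [mul_div_mul_left _ _ two_ne_zero]
  rfl

/-- Since `∂r/∂ξ = ξ/r`, the derivative stays in the same family with larger exponents, so the
formula can be applied again for the second derivative. -/
theorem hasDerivAt_temperedPow_rad (lam a : ℝ) {ξ η : ℝ} (h : 0 < rad (ξ, η)) :
    HasDerivAt (fun t => temperedPow lam a (rad (t, η)))
      (-(ξ * (lam * temperedPow lam (a + 1) (rad (ξ, η))
        + a * temperedPow lam (a + 2) (rad (ξ, η))))) ξ := by
  have hr := hasDerivAt_rad h
  have h1 := ((hr.const_mul lam).neg.exp).mul (hr.rpow_const (p := -a) (Or.inl h.ne'))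
  refine h1.congr_deriv ?_
  unfold temperedPow
  set r := rad (ξ, η)
  have e1 : r ^ (-(a + 1)) = r ^ (-a) / r := by
    rw [← Real.rpow_sub_one h.ne']; ring_nf
  have e2 : r ^ (-(a + 2)) = r ^ (-a) / r / r := by
    rw [← Real.rpow_sub_one h.ne', ← Real.rpow_sub_one h.ne']; ring_nf
  rw [e1, e2, Real.rpow_sub_one h.ne']
  simp only [Pi.neg_apply]
  field_simp
  ring

/-- The first derivative of `ξ ↦ e^{-λ r} r^{-γ}`, `r = √(ξ² + η²)`. -/
def temperedPowD (lam γ ξ η : ℝ) : ℝ :=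
  -(ξ * (lam * temperedPow lam (γ + 1) (rad (ξ, η)) + γ * temperedPow lam (γ + 2) (rad (ξ, η))))

/-- The second derivative of `ξ ↦ e^{-λ r} r^{-γ}`, `r = √(ξ² + η²)`. -/
def temperedPowD2 (lam γ ξ η : ℝ) : ℝ :=
  -(lam * temperedPow lam (γ + 1) (rad (ξ, η)) + γ * temperedPow lam (γ + 2) (rad (ξ, η)))
    + ξ ^ 2 * (lam ^ 2 * temperedPow lam (γ + 2) (rad (ξ, η))
      + (2 * γ + 1) * (lam * temperedPow lam (γ + 3) (rad (ξ, η)))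
      + γ * (γ + 2) * temperedPow lam (γ + 4) (rad (ξ, η)))

theorem hasDerivAt_temperedPowD (lam γ : ℝ) {ξ η : ℝ} (h : 0 < rad (ξ, η)) :
    HasDerivAt (fun t => temperedPowD lam γ t η) (temperedPowD2 lam γ ξ η) ξ := by
  have h1 := (hasDerivAt_temperedPow_rad lam (γ + 1) h).const_mul lam
  have h2 := (hasDerivAt_temperedPow_rad lam (γ + 2) h).const_mul γ
  refine ((hasDerivAt_id ξ).mul (h1.add h2)).neg.congr_deriv ?_
  simp only [temperedPowD2, Pi.add_apply, id]
  rw [show γ + 1 + 1 = γ + 2 by ring, show γ + 1 + 2 = γ + 3 by ring,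
    show γ + 2 + 1 = γ + 3 by ring, show γ + 2 + 2 = γ + 4 by ring]
  ring

theorem abs_temperedPowD_le {lam γ ξ η : ℝ} (hl : 0 ≤ lam) (hγ0 : 0 ≤ γ) (hγ2 : γ ≤ 2)
    (h : 0 < rad (ξ, η)) :
    |temperedPowD lam γ ξ η| * rad (ξ, η) ≤ 3 * rad (ξ, η) ^ (-γ) := by
  have hξ := abs_fst_le_rad (ξ, η)
  simp only at hξ
  unfold temperedPowD
  set r := rad (ξ, η)
  have e : r ^ (-γ) = r ^ 2 * r ^ (-(γ + 2)) := by
    rw [mul_comm, ← Real.rpow_natCast, ← Real.rpow_add h]; norm_num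
  have b1 := mul_temperedPow_le lam (γ + 1) h
  rw [show γ + 1 + 1 = γ + 2 by ring] at b1
  have b2 := temperedPow_le (γ + 2) hl h.le
  have p1 := mul_nonneg hl (temperedPow_nonneg lam (γ + 1) h.le)
  have p2 := temperedPow_nonneg lam (γ + 2) h.le
  have pR : 0 ≤ r ^ (-(γ + 2)) := Real.rpow_nonneg h.le _
  have b3 : γ * temperedPow lam (γ + 2) r ≤ 2 * r ^ (-(γ + 2)) := mul_le_mul hγ2 b2 p2 (by norm_num)
  have p3 := mul_nonneg hγ0 p2
  rw [abs_neg, abs_mul, abs_of_nonneg (add_nonneg p1 p3), e]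
  calc _ ≤ r * (3 * r ^ (-(γ + 2))) * r := by
        gcongr
        linarith
    _ = _ := by ring

theorem abs_temperedPowD2_le {lam γ ξ η : ℝ} (hl : 0 ≤ lam) (hγ0 : 0 ≤ γ) (hγ2 : γ ≤ 2)
    (h : 0 < rad (ξ, η)) :
    |temperedPowD2 lam γ ξ η| * rad (ξ, η) ^ 2 ≤ 18 * rad (ξ, η) ^ (-γ) := by
  have hξ := abs_fst_le_rad (ξ, η)
  simp only at hξ
  unfold temperedPowD2
  set r := rad (ξ, η)
  have e : r ^ (-γ) = r ^ 4 * r ^ (-(γ + 4)) := by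
    rw [mul_comm, ← Real.rpow_natCast, ← Real.rpow_add h]; norm_num
  have e2 : r ^ (-(γ + 2)) = r ^ 2 * r ^ (-(γ + 4)) := by
    rw [mul_comm, ← Real.rpow_natCast, ← Real.rpow_add h]; congr 1; push_cast; ring
  have b1 := mul_temperedPow_le lam (γ + 1) h
  have b2 := temperedPow_le (γ + 2) hl h.le
  have b3 := sq_mul_temperedPow_le (γ + 2) hl h
  have b4 := mul_temperedPow_le lam (γ + 3) h
  have b5 := temperedPow_le (γ + 4) hl h.le
  rw [show γ + 1 + 1 = γ + 2 by ring, e2] at b1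
  rw [e2] at b2
  rw [show γ + 2 + 2 = γ + 4 by ring] at b3
  rw [show γ + 3 + 1 = γ + 4 by ring] at b4
  have p1 := mul_nonneg hl (temperedPow_nonneg lam (γ + 1) h.le)
  have p2 := temperedPow_nonneg lam (γ + 2) h.le
  have p4 := mul_nonneg hl (temperedPow_nonneg lam (γ + 3) h.le)
  have p5 := temperedPow_nonneg lam (γ + 4) h.le
  set R := r ^ (-(γ + 4))
  have pR : 0 ≤ R := Real.rpow_nonneg h.le _
  have c2 : γ * temperedPow lam (γ + 2) r ≤ 2 * (r ^ 2 * R) := mul_le_mul hγ2 b2 p2 (by norm_num)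
  have c4 : (2 * γ + 1) * (lam * temperedPow lam (γ + 3) r) ≤ 5 * R :=
    mul_le_mul (by linarith) b4 p4 (by norm_num)
  have c5 : γ * (γ + 2) * temperedPow lam (γ + 4) r ≤ 8 * R :=
    mul_le_mul (by nlinarith) b5 p5 (by norm_num)
  have q2 := mul_nonneg hγ0 p2
  have q3 := mul_nonneg (sq_nonneg lam) p2
  have q4 := mul_nonneg (show 0 ≤ 2 * γ + 1 by linarith) p4
  have q5 := mul_nonneg (show 0 ≤ γ * (γ + 2) by positivity) p5
  have hsq : ξ ^ 2 ≤ r ^ 2 := by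
    rw [← sq_abs ξ]; gcongr
  rw [e]
  -- With `γ ≤ 2`: `3 = 1 + 2` bounds the part without `ξ²`, and `15 = 2 + 5 + 8` bounds the
  -- coefficient of `ξ²`.
  have main : ∀ A B : ℝ, 0 ≤ A → A ≤ 3 * (r ^ 2 * R) → 0 ≤ B → B ≤ 15 * R →
      |-A + ξ ^ 2 * B| * r ^ 2 ≤ 18 * (r ^ 4 * R) := by
    intro A B hA0 hA hB0 hB
    have : |-A + ξ ^ 2 * B| ≤ 18 * (r ^ 2 * R) := by
      calc _ ≤ |-A| + |ξ ^ 2 * B| := abs_add_le _ _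
        _ = A + ξ ^ 2 * B := by
          rw [abs_neg, abs_of_nonneg hA0, abs_of_nonneg (mul_nonneg (sq_nonneg _) hB0)]
        _ ≤ 3 * (r ^ 2 * R) + r ^ 2 * (15 * R) := by gcongr
        _ = _ := by ring
    calc _ ≤ 18 * (r ^ 2 * R) * r ^ 2 := by gcongr
      _ = _ := by ring
  exact main _ _ (by linarith) (by linarith) (by linarith) (by linarith)

/-! ### The symmetrised difference -/

/-- The pure second partial derivative of `u` in the first variable exists and is bounded
by `M`. -/
def SecondPartialBdd (u : ℝ × ℝ → ℝ) (M : ℝ) : Prop :=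
  ∃ v w : ℝ × ℝ → ℝ, (∀ x y, HasDerivAt (fun t => u (t, y)) (v (x, y)) x) ∧
    (∀ x y, HasDerivAt (fun t => v (t, y)) (w (x, y)) x) ∧ ∀ q, |w q| ≤ M

theorem SecondPartialBdd.nonneg {u : ℝ × ℝ → ℝ} {M : ℝ} (h : SecondPartialBdd u M) : 0 ≤ M := by
  obtain ⟨v, w, -, -, h⟩ := h
  exact (abs_nonneg _).trans (h (0, 0))

/-- The second partial is continuous and inherits the compact support of `u`, hence is bounded. -/
theorem exists_secondPartialBdd {u : ℝ × ℝ → ℝ} (hu : ContDiff ℝ 2 u) (hc : HasCompactSupport u) :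
    ∃ M, SecondPartialBdd u M := by
  have line : ∀ (g : ℝ × ℝ → ℝ), Differentiable ℝ g → ∀ x y,
      HasDerivAt (fun t => g (t, y)) (fderiv ℝ g (x, y) (1, 0)) x := by
    intro g hg x y
    have h2 : HasDerivAt (fun t : ℝ => (t, y)) ((1 : ℝ), (0 : ℝ)) x :=
      (hasDerivAt_id x).prodMk (hasDerivAt_const x y)
    exact (hg (x, y)).hasFDerivAt.comp_hasDerivAt x h2
  have h1 : ContDiff ℝ 1 fun q => fderiv ℝ u q (1, 0) :=
    (hu.fderiv_right (m := 1) (by norm_num)).clm_apply contDiff_const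
  have h2 : Continuous fun q => fderiv ℝ (fun q => fderiv ℝ u q (1, 0)) q (1, 0) :=
    (h1.continuous_fderiv (by norm_num)).clm_apply continuous_const
  obtain ⟨M, hM⟩ := h2.bounded_above_of_compact_support
    ((hc.fderiv_apply (𝕜 := ℝ) (1, 0)).fderiv_apply (𝕜 := ℝ) (1, 0))
  exact ⟨M, fun q => fderiv ℝ u q (1, 0), _, line u (hu.differentiable (by norm_num)),
    line _ (h1.differentiable (by norm_num)), hM⟩

theorem SecondPartialBdd.mono {u : ℝ × ℝ → ℝ} {M M' : ℝ} (h : SecondPartialBdd u M)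
    (hM : M ≤ M') : SecondPartialBdd u M' := by
  obtain ⟨v, w, h1, h2, h3⟩ := h
  exact ⟨v, w, h1, h2, fun q => (h3 q).trans hM⟩

theorem symDiff4_swap (u : ℝ × ℝ → ℝ) (p : ℝ × ℝ) (ξ η : ℝ) :
    symDiff4 (u ∘ Prod.swap) p.swap η ξ = symDiff4 u p ξ η := by
  simp only [symDiff4, Function.comp, Prod.swap]
  ring

theorem rad_swap (ξ η : ℝ) : rad (η, ξ) = rad (ξ, η) := by
  simp only [rad, add_comm]

theorem phi_swap (γ lam : ℝ) (u : ℝ × ℝ → ℝ) (p : ℝ × ℝ) (ξ η : ℝ) :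
    phi γ lam (u ∘ Prod.swap) p.swap η ξ = phi γ lam u p ξ η := by
  rw [phi, phi, symDiff4_swap, rad_swap]

/-- The difference is even in `ξ`, so its first derivative pairs values of `v` at points `2|ξ|`
apart. The Lipschitz bound on `v` gives `2 · M · 2|ξ|`. -/
theorem SecondPartialBdd.symDiff4 {u : ℝ × ℝ → ℝ} {M : ℝ} (h : SecondPartialBdd u M)
    (p : ℝ × ℝ) (η : ℝ) :
    ∃ g' g'' : ℝ → ℝ, (∀ ξ, HasDerivAt (fun t => symDiff4 u p t η) (g' ξ) ξ) ∧
      (∀ ξ, HasDerivAt g' (g'' ξ) ξ) ∧ (∀ ξ, |g' ξ| ≤ 4 * M * |ξ|) ∧ ∀ ξ, |g'' ξ| ≤ 4 * M := by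
  obtain ⟨v, w, hv, hw, hM⟩ := h
  have plus : ∀ (f f' : ℝ × ℝ → ℝ), (∀ x y, HasDerivAt (fun t => f (t, y)) (f' (x, y)) x) →
      ∀ y ξ, HasDerivAt (fun t => f (p.1 + t, y)) (f' (p.1 + ξ, y)) ξ := fun f f' hf y ξ =>
    HasDerivAt.comp_const_add p.1 ξ (hf (p.1 + ξ) y)
  have minus : ∀ (f f' : ℝ × ℝ → ℝ), (∀ x y, HasDerivAt (fun t => f (t, y)) (f' (x, y)) x) →
      ∀ y ξ, HasDerivAt (fun t => f (p.1 - t, y)) (-f' (p.1 - ξ, y)) ξ := fun f f' hf y ξ =>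
    HasDerivAt.comp_const_sub p.1 ξ (hf (p.1 - ξ) y)
  have lip : ∀ y s t, |v (s, y) - v (t, y)| ≤ M * |s - t| := fun y s t =>
    convex_univ.norm_image_sub_le_of_norm_hasDerivWithin_le
      (fun x _ => (hw x y).hasDerivWithinAt) (fun x _ => hM _) (Set.mem_univ t) (Set.mem_univ s)
  refine ⟨fun ξ => v (p.1 + ξ, p.2 + η) + -v (p.1 - ξ, p.2 + η) + -v (p.1 - ξ, p.2 - η)
      + v (p.1 + ξ, p.2 - η),
    fun ξ => w (p.1 + ξ, p.2 + η) + -(-w (p.1 - ξ, p.2 + η)) + -(-w (p.1 - ξ, p.2 - η))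
      + w (p.1 + ξ, p.2 - η), fun ξ => ?_, fun ξ => ?_, fun ξ => ?_, fun ξ => ?_⟩
  · exact ((((plus u v hv _ ξ).add (minus u v hv _ ξ)).add (minus u v hv _ ξ)).add
      (plus u v hv _ ξ)).sub_const _
  · exact (((plus v w hw _ ξ).add (minus v w hw _ ξ).neg).add (minus v w hw _ ξ).neg).add
      (plus v w hw _ ξ)
  · have e : |p.1 + ξ - (p.1 - ξ)| = 2 * |ξ| := by
      rw [show p.1 + ξ - (p.1 - ξ) = 2 * ξ by ring, abs_mul, abs_two]
    have h1 := lip (p.2 + η) (p.1 + ξ) (p.1 - ξ)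
    have h2 := lip (p.2 - η) (p.1 + ξ) (p.1 - ξ)
    rw [e, abs_le] at h1 h2
    exact abs_le.2 ⟨by linarith [h1.1, h2.1], by linarith [h1.2, h2.2]⟩
  · have h1 := abs_le.1 (hM (p.1 + ξ, p.2 + η))
    have h2 := abs_le.1 (hM (p.1 - ξ, p.2 + η))
    have h3 := abs_le.1 (hM (p.1 - ξ, p.2 - η))
    have h4 := abs_le.1 (hM (p.1 + ξ, p.2 - η))
    exact abs_le.2 ⟨by linarith [h1.1, h2.1, h3.1, h4.1], by linarith [h1.2, h2.2, h3.2, h4.2]⟩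

theorem SecondPartialBdd.abs_symDiff4_sub_le {u : ℝ × ℝ → ℝ} {M : ℝ} (h : SecondPartialBdd u M)
    (p : ℝ × ℝ) (ξ η : ℝ) :
    |TemperedFrac.symDiff4 u p ξ η - TemperedFrac.symDiff4 u p 0 η| ≤ 4 * M * ξ ^ 2 := by
  have hM0 := h.nonneg
  obtain ⟨g', g'', h1, -, h3, -⟩ := h.symDiff4 p η
  have := (convex_uIcc (0 : ℝ) ξ).norm_image_sub_le_of_norm_hasDerivWithin_le (C := 4 * M * |ξ|)
    (fun x _ => (h1 x).hasDerivWithinAt)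
    (fun x hx => (h3 x).trans (by
      have := Set.abs_sub_left_of_mem_uIcc hx
      rw [sub_zero, sub_zero] at this
      gcongr)) Set.left_mem_uIcc Set.right_mem_uIcc
  simp only [Real.norm_eq_abs, sub_zero] at this
  refine this.trans (le_of_eq ?_)
  rw [mul_assoc, ← sq, sq_abs]

/-- Moving from `(ξ,η)` to `(0,η)` and then to the origin, parallel to the axes, keeps mixed
partials out of the estimate; the second leg is the first one for `u ∘ Prod.swap`. -/
theorem abs_symDiff4_le {u : ℝ × ℝ → ℝ} {M : ℝ} (h : SecondPartialBdd u M)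
    (h' : SecondPartialBdd (u ∘ Prod.swap) M) (p : ℝ × ℝ) (ξ η : ℝ) :
    |symDiff4 u p ξ η| ≤ 4 * M * rad (ξ, η) ^ 2 := by
  have h1 := h.abs_symDiff4_sub_le p ξ η
  have h2 := h'.abs_symDiff4_sub_le p.swap η 0
  rw [symDiff4_swap, symDiff4_swap] at h2
  have h3 : symDiff4 u p 0 0 = 0 := by simp [symDiff4]; ring
  rw [h3] at h2
  rw [rad_sq]
  rw [abs_le] at *
  exact ⟨by linarith [h1.1, h2.1], by linarith [h1.2, h2.2]⟩

theorem phi_eq (γ lam : ℝ) (u : ℝ × ℝ → ℝ) (p : ℝ × ℝ) (ξ η : ℝ) :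
    phi γ lam u p ξ η = symDiff4 u p ξ η * temperedPow lam γ (rad (ξ, η)) := by
  rw [phi, temperedPow, Real.exp_neg, Real.rpow_neg (rad_nonneg _), div_eq_mul_inv, mul_inv]

/-- In the Leibniz expansion each derivative taken off `g` loses one power of `r` and each one put
on the radial factor costs one, so all terms have size `r^(-γ)`. The constant is `4 (1 + 2·3 + 18) =
100`. -/
theorem exists_secondDeriv_phi {u : ℝ × ℝ → ℝ} {M : ℝ} (h : SecondPartialBdd u M)
    (h' : SecondPartialBdd (u ∘ Prod.swap) M) {γ lam : ℝ} (hl : 0 ≤ lam) (hγ0 : 0 ≤ γ)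
    (hγ2 : γ ≤ 2) (p : ℝ × ℝ) (η : ℝ) :
    ∃ f' f'' : ℝ → ℝ, ∀ ξ, 0 < rad (ξ, η) →
      HasDerivAt (fun t => phi γ lam u p t η) (f' ξ) ξ ∧ HasDerivAt f' (f'' ξ) ξ ∧
        |f'' ξ| ≤ 100 * M * rad (ξ, η) ^ (-γ) := by
  have hM0 := h.nonneg
  obtain ⟨g', g'', h1, h2, h3, h4⟩ := h.symDiff4 p η
  refine ⟨fun ξ => g' ξ * temperedPow lam γ (rad (ξ, η)) + symDiff4 u p ξ η * temperedPowD lam γ ξ η,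
    fun ξ => (g'' ξ * temperedPow lam γ (rad (ξ, η)) + g' ξ * temperedPowD lam γ ξ η)
      + (g' ξ * temperedPowD lam γ ξ η + symDiff4 u p ξ η * temperedPowD2 lam γ ξ η),
    fun ξ hr => ⟨?_, ?_, ?_⟩⟩
  · simp only [phi_eq]
    exact (h1 ξ).mul (hasDerivAt_temperedPow_rad lam γ hr)
  · exact ((h2 ξ).mul (hasDerivAt_temperedPow_rad lam γ hr)).add
      ((h1 ξ).mul (hasDerivAt_temperedPowD lam γ hr))
  · have b0 := temperedPow_le γ hl hr.le
    have b1 := abs_temperedPowD_le hl hγ0 hγ2 hr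
    have b2 := abs_temperedPowD2_le hl hγ0 hγ2 hr
    have a0 := abs_symDiff4_le h h' p ξ η
    have a1 : |g' ξ| ≤ 4 * M * rad (ξ, η) :=
      (h3 ξ).trans (mul_le_mul_of_nonneg_left (abs_fst_le_rad (ξ, η)) (by positivity))
    have c0 : |g'' ξ * temperedPow lam γ (rad (ξ, η))| ≤ 4 * M * rad (ξ, η) ^ (-γ) := by
      rw [abs_mul, abs_of_nonneg (temperedPow_nonneg lam γ hr.le)]
      exact mul_le_mul (h4 ξ) b0 (temperedPow_nonneg lam γ hr.le) (by positivity)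
    have c1 : |g' ξ * temperedPowD lam γ ξ η| ≤ 4 * M * (3 * rad (ξ, η) ^ (-γ)) := by
      rw [abs_mul]
      calc _ ≤ 4 * M * rad (ξ, η) * |temperedPowD lam γ ξ η| := by gcongr
        _ = 4 * M * (|temperedPowD lam γ ξ η| * rad (ξ, η)) := by ring
        _ ≤ _ := by gcongr
    have c2 : |symDiff4 u p ξ η * temperedPowD2 lam γ ξ η| ≤ 4 * M * (18 * rad (ξ, η) ^ (-γ)) := by
      rw [abs_mul]
      calc _ ≤ 4 * M * rad (ξ, η) ^ 2 * |temperedPowD2 lam γ ξ η| := by gcongr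
        _ = 4 * M * (|temperedPowD2 lam γ ξ η| * rad (ξ, η) ^ 2) := by ring
        _ ≤ _ := by gcongr
    rw [abs_le] at *
    exact ⟨by linarith [c0.1, c1.1, c2.1], by linarith [c0.2, c1.2, c2.2]⟩

/-! ### Bilinear interpolation on a cell -/

/-- The bilinear interpolant of `f` at the four corners of the cell `(i, j)`. -/
def bilin (h : ℝ) (f : ℝ → ℝ → ℝ) (i j : ℕ) (q : ℝ × ℝ) : ℝ :=
  (((i + 1) * h - q.1) * ((((j + 1) * h - q.2) * f (i * h) (j * h)
      + (q.2 - j * h) * f (i * h) ((j + 1) * h)) / h)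
    + (q.1 - i * h) * ((((j + 1) * h - q.2) * f ((i + 1) * h) (j * h)
      + (q.2 - j * h) * f ((i + 1) * h) ((j + 1) * h)) / h)) / h

/-- Interpolate first in `ξ` along the line through `q`, then in `η` on the two vertical edges. The
edge errors enter through a convex combination, so they contribute one further `E`. -/
theorem abs_sub_bilin_le {h E : ℝ} (hh : 0 < h) {f : ℝ → ℝ → ℝ} {i j : ℕ} {q : ℝ × ℝ}
    (hq : q ∈ cell h i j)
    (h1 : |f q.1 q.2 - (((i + 1) * h - q.1) * f (i * h) q.2
      + (q.1 - i * h) * f ((i + 1) * h) q.2) / h| ≤ E)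
    (h2 : ∀ ξ : ℝ, ξ ∈ Set.Icc (i * h) ((i + 1) * h) → |f ξ q.2 - (((j + 1) * h - q.2) * f ξ (j * h)
      + (q.2 - j * h) * f ξ ((j + 1) * h)) / h| ≤ E) :
    |f q.1 q.2 - bilin h f i j q| ≤ 2 * E := by
  obtain ⟨⟨ha, hb⟩, -⟩ := hq
  have hlt : (i : ℝ) * h ≤ (i + 1) * h := by linarith
  have h3 := h2 _ (Set.left_mem_Icc.2 hlt)
  have h4 := h2 _ (Set.right_mem_Icc.2 hlt)
  unfold bilin
  set A := f q.1 q.2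
  set B := f (i * h) q.2
  set C := f ((i + 1) * h) q.2
  set B' := (((j + 1) * h - q.2) * f (i * h) (j * h)
      + (q.2 - j * h) * f (i * h) ((j + 1) * h)) / h
  set C' := (((j + 1) * h - q.2) * f ((i + 1) * h) (j * h)
      + (q.2 - j * h) * f ((i + 1) * h) ((j + 1) * h)) / h
  have e : A - (((i + 1) * h - q.1) * B' + (q.1 - i * h) * C') / h
      = (A - (((i + 1) * h - q.1) * B + (q.1 - i * h) * C) / h)
        + (((i + 1) * h - q.1) * (B - B') + (q.1 - i * h) * (C - C')) / h := by
    field_simp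
    ring
  have b2 : |(((i + 1) * h - q.1) * (B - B') + (q.1 - i * h) * (C - C')) / h| ≤ E := by
    rw [abs_div, abs_of_pos hh, div_le_iff₀ hh]
    refine (abs_add_le _ _).trans ?_
    rw [abs_mul, abs_mul, abs_of_nonneg (sub_nonneg.2 hb), abs_of_nonneg (sub_nonneg.2 ha)]
    calc _ ≤ ((i + 1) * h - q.1) * E + (q.1 - i * h) * E := by
          gcongr
      _ = _ := by ring
  rw [e]
  exact (abs_add_le _ _).trans (by linarith)

/-- A cell other than the singular one is at distance at least `h` from the origin, so moving within
it changes each coordinate by at most `rad q'`. Powers of `r` are thus comparable across the cell.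
-/
theorem rad_le_three_mul_rad {h : ℝ} (hh : 0 < h) {i j : ℕ} (hij : (i, j) ≠ (0, 0))
    {q q' : ℝ × ℝ} (hq : q ∈ cell h i j) (hq' : q' ∈ cell h i j) :
    h ≤ rad q' ∧ rad q ≤ 3 * rad q' := by
  obtain ⟨⟨a1, a2⟩, ⟨a3, a4⟩⟩ := hq
  obtain ⟨⟨b1, b2⟩, ⟨b3, b4⟩⟩ := hq'
  have c1 := (le_abs_self _).trans (abs_fst_le_rad q')
  have c2 := (le_abs_self _).trans (abs_snd_le_rad q')
  have i0 : 0 ≤ (i : ℝ) * h := by positivity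
  have j0 : 0 ≤ (j : ℝ) * h := by positivity
  have hr : h ≤ rad q' := by
    rcases Nat.eq_zero_or_pos i with rfl | hi
    · rcases Nat.eq_zero_or_pos j with rfl | hj
      · exact absurd rfl hij
      · have : (1 : ℝ) ≤ j := by exact_mod_cast hj
        nlinarith
    · have : (1 : ℝ) ≤ i := by exact_mod_cast hi
      nlinarith
  refine ⟨hr, ?_⟩
  have hs := rad_sq q'
  refine Real.sqrt_le_iff.2 ⟨by linarith, ?_⟩
  have d1 : q.1 ^ 2 ≤ (q'.1 + rad q') ^ 2 := by
    apply pow_le_pow_left₀ <;> linarith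
  have d2 : q.2 ^ 2 ≤ (q'.2 + rad q') ^ 2 := by
    apply pow_le_pow_left₀ <;> linarith
  nlinarith

theorem rad_rpow_le_of_mem_cell {h γ : ℝ} (hh : 0 < h) (hγ0 : 0 ≤ γ) (hγ2 : γ ≤ 2) {i j : ℕ}
    (hij : (i, j) ≠ (0, 0)) {q q' : ℝ × ℝ} (hq : q ∈ cell h i j) (hq' : q' ∈ cell h i j) :
    rad q' ^ (-γ) ≤ 9 * rad q ^ (-γ) := by
  have h1 := rad_le_three_mul_rad hh hij hq hq'
  have h2 := rad_le_three_mul_rad hh hij hq' hq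
  have hq0 : 0 < rad q := by linarith
  have hq0' : 0 < rad q' := by linarith
  calc rad q' ^ (-γ) ≤ (rad q / 3) ^ (-γ) :=
        Real.rpow_le_rpow_of_nonpos (by positivity) (by linarith) (by linarith)
    _ = 3 ^ γ * rad q ^ (-γ) := by
        rw [Real.div_rpow hq0.le (by norm_num), Real.rpow_neg (by norm_num : (0 : ℝ) ≤ 3),
          div_inv_eq_mul, mul_comm]
    _ ≤ 9 * rad q ^ (-γ) := by
        gcongr
        calc (3 : ℝ) ^ γ ≤ 3 ^ (2 : ℝ) := Real.rpow_le_rpow_of_exponent_le (by norm_num) hγ2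
          _ = 9 := by norm_num

theorem abs_phi_sub_linearInterp_le {u : ℝ × ℝ → ℝ} {M : ℝ} (hu : SecondPartialBdd u M)
    (hu' : SecondPartialBdd (u ∘ Prod.swap) M) {γ lam h : ℝ} (hl : 0 ≤ lam) (hγ0 : 0 ≤ γ)
    (hγ2 : γ ≤ 2) (hh : 0 < h) (p : ℝ × ℝ) {i j : ℕ} (hij : (i, j) ≠ (0, 0))
    {q q' : ℝ × ℝ} (hq : q ∈ cell h i j) (hq' : q' ∈ cell h i j) :
    |phi γ lam u p q'.1 q'.2 - (((i + 1) * h - q'.1) * phi γ lam u p (i * h) q'.2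
      + (q'.1 - i * h) * phi γ lam u p ((i + 1) * h) q'.2) / h|
      ≤ 900 * M * h ^ 2 * rad q ^ (-γ) := by
  have hM0 := hu.nonneg
  obtain ⟨f', f'', H⟩ := exists_secondDeriv_phi hu hu' hl hγ0 hγ2 p q'.2
  have hmem : ∀ x ∈ Set.Icc (i * h) ((i + 1) * h), (x, q'.2) ∈ cell h i j := fun x hx => ⟨hx, hq'.2⟩
  have hpos : ∀ x ∈ Set.Icc (i * h) ((i + 1) * h), 0 < rad (x, q'.2) := fun x hx =>
    hh.trans_le (rad_le_three_mul_rad hh hij hq (hmem x hx)).1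
  have := abs_sub_linearInterp_le (f := fun t => phi γ lam u p t q'.2) (f' := f') (f'' := f'')
    (M := 900 * M * rad q ^ (-γ)) (a := i * h) (b := (i + 1) * h) (t := q'.1) (by linarith)
    (fun x hx => (H x (hpos x hx)).1) (fun x hx => (H x (hpos x hx)).2.1)
    (fun x hx => ((H x (hpos x hx)).2.2).trans (by
      have := rad_rpow_le_of_mem_cell hh hγ0 hγ2 hij hq (hmem x hx)
      calc _ ≤ 100 * M * (9 * rad q ^ (-γ)) := by gcongr
        _ = _ := by ring)) hq'.1
  rw [show ((i : ℝ) + 1) * h - i * h = h by ring] at this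
  exact this.trans (le_of_eq (by ring))

theorem cell_swap {h : ℝ} {i j : ℕ} {q : ℝ × ℝ} (hq : q ∈ cell h i j) : q.swap ∈ cell h j i :=
  ⟨hq.2, hq.1⟩

theorem abs_phi_sub_bilin_le {u : ℝ × ℝ → ℝ} {M : ℝ} (hu : SecondPartialBdd u M)
    (hu' : SecondPartialBdd (u ∘ Prod.swap) M) {γ lam h : ℝ} (hl : 0 ≤ lam) (hγ0 : 0 ≤ γ)
    (hγ2 : γ ≤ 2) (hh : 0 < h) (p : ℝ × ℝ) {i j : ℕ} (hij : (i, j) ≠ (0, 0))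
    {q : ℝ × ℝ} (hq : q ∈ cell h i j) :
    |phi γ lam u p q.1 q.2 - bilin h (phi γ lam u p) i j q|
      ≤ 1800 * M * h ^ 2 * rad q ^ (-γ) := by
  refine (abs_sub_bilin_le hh hq (abs_phi_sub_linearInterp_le hu hu' hl hγ0 hγ2 hh p hij hq hq)
    fun ξ hξ => ?_).trans (le_of_eq (by ring))
  have hji : (j, i) ≠ (0, 0) := fun e => hij (by simp_all)
  -- The `η` direction is the `ξ` estimate for `u ∘ Prod.swap` on the transposed cell.
  have hu2 : SecondPartialBdd ((u ∘ Prod.swap) ∘ Prod.swap) M := by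
    rwa [Function.comp_assoc, Prod.swap_swap_eq, Function.comp_id]
  have := abs_phi_sub_linearInterp_le hu' hu2 hl hγ0 hγ2 hh p.swap hji (cell_swap hq)
    (q' := (q.2, ξ)) ⟨hq.2, hξ⟩
  have er : rad q.swap = rad q := rad_swap q.1 q.2
  simp only [phi_swap, er] at this
  exact this

/-! ### Radial integrals -/

/-- Twice the area of the unit ball of the sup norm on `ℝ × ℝ`. -/
def supBallConst : ℝ := 2 * volume.real (Metric.ball (0 : ℝ × ℝ) 1)

theorem supBallConst_nonneg : 0 ≤ supBallConst := by
  unfold supBallConst; positivity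

/-- Integration in polar form for the sup norm: in dimension two the radial density is `supBallConst
* y`. -/
theorem integrableOn_norm_rpow_far {s R : ℝ} (hs : 2 < s) (hR : 0 < R) :
    IntegrableOn (fun q : ℝ × ℝ => ‖q‖ ^ (-s)) {q | R < ‖q‖} ∧
      ∫ q in {q : ℝ × ℝ | R < ‖q‖}, ‖q‖ ^ (-s) = supBallConst * (R ^ (2 - s) / (s - 2)) := by
  have hm : MeasurableSet {q : ℝ × ℝ | R < ‖q‖} := measurableSet_lt measurable_const measurable_norm
  have hd : Module.finrank ℝ (ℝ × ℝ) - 1 = 1 := by simp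
  have e0 : {q : ℝ × ℝ | R < ‖q‖}.indicator (fun q : ℝ × ℝ => ‖q‖ ^ (-s))
      = fun q => (Set.Ioi R).indicator (fun y : ℝ => y ^ (-s)) ‖q‖ := by
    ext q; simp [Set.indicator]
  have e1 : ∀ y ∈ Set.Ioi (0 : ℝ), y ^ 1 • (Set.Ioi R).indicator (fun y : ℝ => y ^ (-s)) y
      = (Set.Ioi R).indicator (fun y : ℝ => y ^ (1 - s)) y := by
    intro y (hy : 0 < y)
    by_cases h : y ∈ Set.Ioi R
    · simp only [Set.indicator_of_mem h, pow_one, smul_eq_mul]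
      rw [sub_eq_add_neg, Real.rpow_add hy, Real.rpow_one]
    · simp [Set.indicator_of_notMem h]
  have hsub : Set.Ioi (0 : ℝ) ∩ Set.Ioi R = Set.Ioi R :=
    Set.inter_eq_right.2 (Set.Ioi_subset_Ioi hR.le)
  constructor
  · rw [← integrable_indicator_iff hm, e0,
      integrable_fun_norm_addHaar (volume : Measure (ℝ × ℝ)), hd,
      integrableOn_congr_fun e1 measurableSet_Ioi, IntegrableOn,
      integrable_indicator_iff measurableSet_Ioi, IntegrableOn,
      Measure.restrict_restrict measurableSet_Ioi, Set.inter_comm, hsub]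
    exact integrableOn_Ioi_rpow_of_lt (by linarith) hR
  · rw [← integral_indicator hm, e0, integral_fun_norm_addHaar (volume : Measure (ℝ × ℝ)), hd,
      setIntegral_congr_fun measurableSet_Ioi e1, setIntegral_indicator measurableSet_Ioi, hsub,
      integral_Ioi_rpow_of_lt (by linarith) hR]
    simp only [Module.finrank_prod, Module.finrank_self, smul_eq_mul, nsmul_eq_mul, supBallConst]
    rw [show 1 - s + 1 = 2 - s by ring, show s - 2 = -(2 - s) by ring, div_neg, neg_div]
    push_cast
    ring

theorem integrableOn_norm_rpow_near {s R : ℝ} (hs : s < 2) (hR : 0 < R) :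
    IntegrableOn (fun q : ℝ × ℝ => ‖q‖ ^ (-s)) {q | ‖q‖ ≤ R} ∧
      ∫ q in {q : ℝ × ℝ | ‖q‖ ≤ R}, ‖q‖ ^ (-s) = supBallConst * (R ^ (2 - s) / (2 - s)) := by
  have hm : MeasurableSet {q : ℝ × ℝ | ‖q‖ ≤ R} := measurableSet_le measurable_norm measurable_const
  have hd : Module.finrank ℝ (ℝ × ℝ) - 1 = 1 := by simp
  have e0 : {q : ℝ × ℝ | ‖q‖ ≤ R}.indicator (fun q : ℝ × ℝ => ‖q‖ ^ (-s))
      = fun q => (Set.Iic R).indicator (fun y : ℝ => y ^ (-s)) ‖q‖ := by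
    ext q; simp [Set.indicator]
  have e1 : ∀ y ∈ Set.Ioi (0 : ℝ), y ^ 1 • (Set.Iic R).indicator (fun y : ℝ => y ^ (-s)) y
      = (Set.Iic R).indicator (fun y : ℝ => y ^ (1 - s)) y := by
    intro y (hy : 0 < y)
    by_cases h : y ∈ Set.Iic R
    · simp only [Set.indicator_of_mem h, pow_one, smul_eq_mul]
      rw [sub_eq_add_neg, Real.rpow_add hy, Real.rpow_one]
    · simp [Set.indicator_of_notMem h]
  have hsub : Set.Ioi (0 : ℝ) ∩ Set.Iic R = Set.Ioc 0 R := Set.Ioi_inter_Iic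
  constructor
  · rw [← integrable_indicator_iff hm, e0,
      integrable_fun_norm_addHaar (volume : Measure (ℝ × ℝ)), hd,
      integrableOn_congr_fun e1 measurableSet_Ioi, IntegrableOn,
      integrable_indicator_iff measurableSet_Iic, IntegrableOn,
      Measure.restrict_restrict measurableSet_Iic, Set.inter_comm, hsub]
    exact (intervalIntegral.intervalIntegrable_rpow' (by linarith)).1
  · rw [← integral_indicator hm, e0, integral_fun_norm_addHaar (volume : Measure (ℝ × ℝ)), hd,
      setIntegral_congr_fun measurableSet_Ioi e1, setIntegral_indicator measurableSet_Iic, hsub,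
      ← intervalIntegral.integral_of_le hR.le, integral_rpow (Or.inl (by linarith))]
    simp only [Module.finrank_prod, Module.finrank_self, smul_eq_mul, nsmul_eq_mul, supBallConst]
    rw [show 1 - s + 1 = 2 - s by ring, Real.zero_rpow (by linarith)]
    push_cast
    ring

theorem rad_rpow_neg_le {s : ℝ} (hs : 0 ≤ s) (q : ℝ × ℝ) : rad q ^ (-s) ≤ ‖q‖ ^ (-s) := by
  rcases eq_or_ne q 0 with rfl | hq
  · simp [rad]
  · exact Real.rpow_le_rpow_of_nonpos (norm_pos_iff.2 hq) (norm_le_rad q) (by linarith)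

theorem weight_eq (β γ : ℝ) (q : ℝ × ℝ) : weight β γ q = rad q ^ (-(2 + β - γ)) := by
  rw [weight, ← rad_sq, ← Real.rpow_natCast, ← Real.rpow_mul (rad_nonneg q)]
  congr 1
  push_cast
  ring

theorem measurable_weight (β γ : ℝ) : Measurable (weight β γ) := by
  unfold weight; fun_prop

theorem integrableOn_weight_near {β γ R : ℝ} (hβ : 0 < β) (hβγ : β < γ) (hγ2 : γ ≤ 2)
    (hR : 0 < R) : IntegrableOn (weight β γ) {q | ‖q‖ ≤ R} := by
  refine (integrableOn_norm_rpow_near (s := 2 + β - γ) (by linarith) hR).1.mono'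
    (measurable_weight β γ).aestronglyMeasurable (ae_of_all _ fun q => ?_)
  rw [weight_eq, Real.norm_of_nonneg (Real.rpow_nonneg (rad_nonneg q) _)]
  exact rad_rpow_neg_le (by linarith) q

theorem cell_subset_norm_le {h : ℝ} (hh : 0 < h) (i j : ℕ) :
    cell h i j ⊆ {q | ‖q‖ ≤ (i + j + 1) * h} := by
  rintro q ⟨⟨a1, a2⟩, ⟨a3, a4⟩⟩
  have i0 : 0 ≤ (i : ℝ) * h := by positivity
  have j0 : 0 ≤ (j : ℝ) * h := by positivity
  rw [Set.mem_ofPred_eq, Prod.norm_def, Real.norm_of_nonneg (i0.trans a1),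
    Real.norm_of_nonneg (j0.trans a3)]
  exact max_le (by linarith) (by linarith)

theorem isCompact_cell (h : ℝ) (i j : ℕ) : IsCompact (cell h i j) :=
  isCompact_Icc.prod isCompact_Icc

theorem integrableOn_weight_cell {β γ h : ℝ} (hβ : 0 < β) (hβγ : β < γ) (hγ2 : γ ≤ 2)
    (hh : 0 < h) (i j : ℕ) : IntegrableOn (weight β γ) (cell h i j) :=
  (integrableOn_weight_near hβ hβγ hγ2 (by positivity)).mono_set (cell_subset_norm_le hh i j)

theorem integrableOn_mul_weight_cell {β γ h : ℝ} (hβ : 0 < β) (hβγ : β < γ) (hγ2 : γ ≤ 2)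
    (hh : 0 < h) (i j : ℕ) {f : ℝ × ℝ → ℝ} (hf : Continuous f) :
    IntegrableOn (fun q => f q * weight β γ q) (cell h i j) :=
  (integrableOn_weight_cell hβ hβγ hγ2 hh i j).continuousOn_mul hf.continuousOn
    (isCompact_cell h i j)

theorem continuous_bilin (h : ℝ) (f : ℝ → ℝ → ℝ) (i j : ℕ) : Continuous (bilin h f i j) := by
  unfold bilin; fun_prop

/-- The interpolant is a combination of `1, ξ, η, ξη`, so its weighted integral is a combination of
the four moments. They are finite even on the singular cell, because `β < γ`. -/
theorem interpCell_eq_integral {β γ h : ℝ} (hβ : 0 < β) (hβγ : β < γ) (hγ2 : γ ≤ 2)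
    (hh : 0 < h) (f : ℝ → ℝ → ℝ) (i j : ℕ) :
    interpCell β γ h f i j = ∫ q in cell h i j, bilin h f i j q * weight β γ q := by
  have i1 := integrableOn_mul_weight_cell hβ hβγ hγ2 hh i j continuous_fst
  have i2 := integrableOn_mul_weight_cell hβ hβγ hγ2 hh i j continuous_snd
  have i3 := integrableOn_mul_weight_cell hβ hβγ hγ2 hh i j
    (f := fun q => q.1 * q.2) (by fun_prop)
  have i0 := integrableOn_weight_cell hβ hβγ hγ2 hh i j
  have key : ∀ a b c d : ℝ, ∫ q in cell h i j, (a * (q.1 * q.2 * weight β γ q)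
      + b * (q.1 * weight β γ q) + c * (q.2 * weight β γ q) + d * weight β γ q)
      = a * (h ^ 2 * Gxieta β γ h i j) + b * (h ^ 2 * Gxi β γ h i j)
        + c * (h ^ 2 * Geta β γ h i j) + d * (h ^ 2 * G β γ h i j) := by
    intro a b c d
    have j1 : Integrable (fun q : ℝ × ℝ => a * (q.1 * q.2 * weight β γ q)
        + b * (q.1 * weight β γ q)) (volume.restrict (cell h i j)) :=
      (i3.const_mul a).add (i1.const_mul b)
    have j2 : Integrable (fun q : ℝ × ℝ => a * (q.1 * q.2 * weight β γ q)
        + b * (q.1 * weight β γ q) + c * (q.2 * weight β γ q)) (volume.restrict (cell h i j)) :=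
      j1.add (i2.const_mul c)
    rw [integral_add j2 (i0.const_mul d), integral_add j1 (i2.const_mul c),
      integral_add (i3.const_mul a) (i1.const_mul b)]
    simp only [integral_const_mul, Gxieta, Gxi, Geta, G]
    have : h ^ 2 ≠ 0 := by positivity
    field_simp
  set x₀ : ℝ := i * h with hx₀
  set x₁ : ℝ := (i + 1) * h with hx₁
  set y₀ : ℝ := j * h with hy₀
  set y₁ : ℝ := (j + 1) * h with hy₁
  -- The arguments are the coefficients of `ξη`, `ξ`, `η` and `1` in the bilinear interpolant.
  have := key ((f x₀ y₀ - f x₁ y₀ - f x₀ y₁ + f x₁ y₁) / h ^ 2)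
    ((-y₁ * f x₀ y₀ + y₁ * f x₁ y₀ + y₀ * f x₀ y₁ - y₀ * f x₁ y₁) / h ^ 2)
    ((-x₁ * f x₀ y₀ + x₀ * f x₁ y₀ + x₁ * f x₀ y₁ - x₀ * f x₁ y₁) / h ^ 2)
    ((x₁ * y₁ * f x₀ y₀ - x₀ * y₁ * f x₁ y₀ - x₁ * y₀ * f x₀ y₁ + x₀ * y₀ * f x₁ y₁) / h ^ 2)
  have e1 : interpCell β γ h f i j = _ := Eq.trans (by
    simp only [interpCell]
    rw [← hx₀, ← hx₁, ← hy₀, ← hy₁]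
    field_simp
    ring) this.symm
  rw [e1]
  congr 1
  ext q
  unfold bilin
  rw [← hx₀, ← hx₁, ← hy₀, ← hy₁]
  field_simp
  ring

/-! ### The symmetrised integrand -/

theorem kernel_eq (β lam : ℝ) (q : ℝ × ℝ) : kernel β lam q = temperedPow lam (2 + β) (rad q) := by
  rw [kernel, temperedPow, Real.exp_neg, Real.rpow_neg (rad_nonneg _), one_div, mul_inv]

theorem measurable_kernel (β lam : ℝ) : Measurable (kernel β lam) := by
  have := continuous_rad.measurable
  unfold kernel; fun_prop

theorem kernel_nonneg (β lam : ℝ) (q : ℝ × ℝ) : 0 ≤ kernel β lam q := by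
  rw [kernel_eq]; exact temperedPow_nonneg _ _ (rad_nonneg q)

theorem kernel_le_norm_rpow {β lam : ℝ} (hβ : 0 < β) (hl : 0 ≤ lam) (q : ℝ × ℝ) :
    kernel β lam q ≤ ‖q‖ ^ (-(2 + β)) := by
  rw [kernel_eq]
  exact (temperedPow_le _ hl (rad_nonneg q)).trans (rad_rpow_neg_le (by linarith) q)

theorem rad_pos {q : ℝ × ℝ} (hq : q ≠ 0) : 0 < rad q := (norm_pos_iff.2 hq).trans_le (norm_le_rad q)

/-- The symmetrised integrand `g(ξ,η) / (e^{λ r} r^{2+β})`. -/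
def symIntegrand (β lam : ℝ) (u : ℝ × ℝ → ℝ) (p q : ℝ × ℝ) : ℝ :=
  symDiff4 u p q.1 q.2 * kernel β lam q

theorem abs_symIntegrand_le {u : ℝ × ℝ → ℝ} {M : ℝ} (hu : SecondPartialBdd u M)
    (hu' : SecondPartialBdd (u ∘ Prod.swap) M) {β lam : ℝ} (hβ : 0 < β) (hl : 0 ≤ lam)
    (p q : ℝ × ℝ) : |symIntegrand β lam u p q| ≤ 4 * M * ‖q‖ ^ (-β) := by
  have hM0 := hu.nonneg
  rw [symIntegrand, abs_mul, abs_of_nonneg (kernel_nonneg β lam q)]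
  have h1 := abs_symDiff4_le hu hu' p q.1 q.2
  rcases eq_or_ne q 0 with rfl | hq
  · have h2 : |symDiff4 u p (0 : ℝ × ℝ).1 (0 : ℝ × ℝ).2| = 0 :=
      le_antisymm (h1.trans_eq (by simp [rad])) (abs_nonneg _)
    rw [h2, zero_mul]
    positivity
  · have hr := rad_pos hq
    have h2 : kernel β lam q ≤ rad q ^ (-(2 + β)) := by
      rw [kernel_eq]; exact temperedPow_le _ hl hr.le
    calc _ ≤ 4 * M * rad q ^ 2 * rad q ^ (-(2 + β)) :=
          mul_le_mul h1 h2 (kernel_nonneg _ _ _) (by positivity)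
      _ = 4 * M * rad q ^ (-β) := by
          rw [mul_assoc, ← Real.rpow_natCast, ← Real.rpow_add hr]
          congr 2; push_cast; ring
      _ ≤ _ := by
          exact mul_le_mul_of_nonneg_left (rad_rpow_neg_le hβ.le q) (by positivity)

theorem measurable_symIntegrand (β lam : ℝ) {u : ℝ × ℝ → ℝ} (hu : Continuous u) (p : ℝ × ℝ) :
    Measurable (symIntegrand β lam u p) := by
  refine Measurable.mul (Continuous.measurable ?_) (measurable_kernel β lam)
  unfold symDiff4
  fun_prop

/-- Near the origin the second-order bound leaves `‖q‖ ^ (-β)`, integrable for `β < 2`; far away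
boundedness of `u` leaves `‖q‖ ^ (-(2 + β))`. -/
theorem integrable_symIntegrand {u : ℝ × ℝ → ℝ} {M B : ℝ} (hc : Continuous u)
    (hB : ∀ q, |u q| ≤ B) (hu : SecondPartialBdd u M)
    (hu' : SecondPartialBdd (u ∘ Prod.swap) M) {β lam : ℝ} (hβ : 0 < β) (hβ2 : β < 2)
    (hl : 0 ≤ lam) (p : ℝ × ℝ) : Integrable (symIntegrand β lam u p) := by
  have hm := (measurable_symIntegrand β lam hc p).aestronglyMeasurable (μ := volume)
  have e : {q : ℝ × ℝ | ‖q‖ ≤ 1} ∪ {q : ℝ × ℝ | 1 < ‖q‖} = Set.univ := by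
    ext q; simp [le_or_gt]
  rw [← integrableOn_univ, ← e]
  refine IntegrableOn.union ?_ ?_
  · refine ((integrableOn_norm_rpow_near hβ2 one_pos).1.const_mul (4 * M)).mono' hm.restrict
      (ae_of_all _ fun q => abs_symIntegrand_le hu hu' hβ hl p q)
  · refine ((integrableOn_norm_rpow_far (s := 2 + β) (by linarith) one_pos).1.const_mul
      (8 * B)).mono' hm.restrict (ae_of_all _ fun q => ?_)
    rw [symIntegrand, Real.norm_eq_abs, abs_mul, abs_of_nonneg (kernel_nonneg β lam q)]
    have h0 := abs_le.1 (hB p)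
    have h1 := abs_le.1 (hB (p.1 + q.1, p.2 + q.2))
    have h2 := abs_le.1 (hB (p.1 - q.1, p.2 + q.2))
    have h3 := abs_le.1 (hB (p.1 - q.1, p.2 - q.2))
    have h4 := abs_le.1 (hB (p.1 + q.1, p.2 - q.2))
    have h5 : |symDiff4 u p q.1 q.2| ≤ 8 * B := by
      unfold symDiff4
      exact abs_le.2 ⟨by linarith [h0.2, h1.1, h2.1, h3.1, h4.1],
        by linarith [h0.1, h1.2, h2.2, h3.2, h4.2]⟩
    exact mul_le_mul h5 (kernel_le_norm_rpow hβ hl q) (kernel_nonneg _ _ _)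
      ((abs_nonneg _).trans h5)

/-! ### Reflections and the principal value -/

theorem measurePreserving_reflectFst :
    MeasurePreserving ((MeasurableEquiv.neg ℝ).prodCongr (MeasurableEquiv.refl ℝ)) volume volume :=
  (Measure.measurePreserving_neg (volume : Measure ℝ)).prod (MeasurePreserving.id volume)

theorem measurePreserving_reflectSnd :
    MeasurePreserving ((MeasurableEquiv.refl ℝ).prodCongr (MeasurableEquiv.neg ℝ)) volume volume :=
  (MeasurePreserving.id volume).prod (Measure.measurePreserving_neg (volume : Measure ℝ))

theorem integral_reflections {f : ℝ × ℝ → ℝ} (hf : Integrable f) :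
    ∫ q : ℝ × ℝ, (f q + f (-q.1, q.2) + f (-q.1, -q.2) + f (q.1, -q.2)) = 4 * ∫ q, f q := by
  have fst : ∀ {g : ℝ × ℝ → ℝ}, Integrable g → Integrable (fun q : ℝ × ℝ => g (-q.1, q.2)) ∧
      ∫ q : ℝ × ℝ, g (-q.1, q.2) = ∫ q, g q := fun {g} hg =>
    ⟨measurePreserving_reflectFst.integrable_comp_of_integrable hg,
      measurePreserving_reflectFst.integral_comp' g⟩
  have snd : ∀ {g : ℝ × ℝ → ℝ}, Integrable g → Integrable (fun q : ℝ × ℝ => g (q.1, -q.2)) ∧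
      ∫ q : ℝ × ℝ, g (q.1, -q.2) = ∫ q, g q := fun {g} hg =>
    ⟨measurePreserving_reflectSnd.integrable_comp_of_integrable hg,
      measurePreserving_reflectSnd.integral_comp' g⟩
  have h1 := fst hf
  have h2 := snd hf
  have h3 := fst h2.1
  simp only at h3
  rw [integral_add _ h2.1, integral_add _ h3.1, integral_add hf h1.1, h1.2, h3.2, h2.2]
  · ring
  · exact hf.add h1.1
  · exact (hf.add h1.1).add h3.1

/-- Fubini, with the one-dimensional folding `integral_comp_abs` in each variable. -/
theorem integral_eq_four_mul_quadrant {f : ℝ × ℝ → ℝ} (hf : Integrable f)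
    (heven : ∀ q : ℝ × ℝ, f q = f (|q.1|, |q.2|)) :
    ∫ q, f q = 4 * ∫ q in Set.Ioi (0 : ℝ) ×ˢ Set.Ioi (0 : ℝ), f q := by
  have inner : ∀ x : ℝ, ∫ y, f (x, y) = 2 * ∫ y in Set.Ioi (0 : ℝ), f (|x|, y) := by
    intro x
    rw [← integral_comp_abs (f := fun y => f (|x|, y))]
    exact integral_congr_ae (ae_of_all _ fun y => heven (x, y))
  have e : (volume : Measure (ℝ × ℝ)) = (volume : Measure ℝ).prod volume := rfl
  rw [e, setIntegral_prod f (by rw [← e]; exact hf.integrableOn), integral_prod f (by rwa [← e])]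
  simp only [inner]
  rw [integral_comp_abs (f := fun x => 2 * ∫ y in Set.Ioi (0 : ℝ), f (x, y)), integral_const_mul]
  ring

theorem symIntegrand_even (β lam : ℝ) (u : ℝ × ℝ → ℝ) (p q : ℝ × ℝ) :
    symIntegrand β lam u p q = symIntegrand β lam u p (|q.1|, |q.2|) := by
  have h1 : kernel β lam (|q.1|, |q.2|) = kernel β lam q := by
    simp only [kernel, rad, sq_abs]
  unfold symIntegrand
  rw [h1]
  congr 1
  simp only [symDiff4]
  rcases abs_choice q.1 with h | h <;> rcases abs_choice q.2 with h' | h' <;> rw [h, h'] <;>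
    simp only [sub_neg_eq_add, ← sub_eq_add_neg] <;> ring

theorem measurableSet_lt_rad (ε : ℝ) : MeasurableSet {q : ℝ × ℝ | ε < rad q} :=
  measurableSet_lt measurable_const continuous_rad.measurable

theorem integrableOn_pvIntegrand {u : ℝ × ℝ → ℝ} {B : ℝ} (hc : Continuous u)
    (hB : ∀ q, |u q| ≤ B) {β lam : ℝ} (hβ : 0 < β) (hl : 0 ≤ lam) (p : ℝ × ℝ) {ε : ℝ}
    (hε : 0 < ε) : IntegrableOn (pvIntegrand β lam u p) {q | ε < rad q} := by
  have hsub : {q : ℝ × ℝ | ε < rad q} ⊆ {q | ε / 2 < ‖q‖} := fun q (hq : ε < rad q) => by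
    have := rad_le_two_mul_norm q
    show ε / 2 < ‖q‖
    linarith
  have hm : Measurable (pvIntegrand β lam u p) := by
    refine Measurable.mul (Continuous.measurable ?_) (measurable_kernel β lam)
    fun_prop
  refine IntegrableOn.mono_set ?_ hsub
  refine ((integrableOn_norm_rpow_far (s := 2 + β) (by linarith) (half_pos hε)).1.const_mul
    (2 * B)).mono' hm.aestronglyMeasurable (ae_of_all _ fun q => ?_)
  rw [pvIntegrand, Real.norm_eq_abs, abs_mul, abs_of_nonneg (kernel_nonneg β lam q)]
  have h0 := abs_le.1 (hB p)
  have h1 := abs_le.1 (hB (p + q))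
  have h5 : |u (p + q) - u p| ≤ 2 * B :=
    abs_le.2 ⟨by linarith [h0.2, h1.1], by linarith [h0.1, h1.2]⟩
  exact mul_le_mul h5 (kernel_le_norm_rpow hβ hl q) (kernel_nonneg _ _ _) ((abs_nonneg _).trans h5)

/-- The exterior of a Euclidean disc and the kernel are both invariant under the reflections, so the
four reflected integrands add up to the symmetrised one. -/
theorem four_mul_pvTrunc {u : ℝ × ℝ → ℝ} {B : ℝ} (hc : Continuous u)
    (hB : ∀ q, |u q| ≤ B) {β lam : ℝ} (hβ : 0 < β) (hl : 0 ≤ lam) (p : ℝ × ℝ) {ε : ℝ}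
    (hε : 0 < ε) :
    4 * pvTrunc β lam u p ε = ∫ q in {q : ℝ × ℝ | ε < rad q}, symIntegrand β lam u p q := by
  have hi := (integrable_indicator_iff (measurableSet_lt_rad ε)).2
    (integrableOn_pvIntegrand hc hB hβ hl p hε)
  rw [pvTrunc, ← integral_indicator (measurableSet_lt_rad ε), ← integral_reflections hi,
    ← integral_indicator (measurableSet_lt_rad ε)]
  congr 1
  ext q
  have r1 : rad (-q.1, q.2) = rad q := by simp only [rad, neg_sq]
  have r2 : rad (-q.1, -q.2) = rad q := by simp only [rad, neg_sq]
  have r3 : rad (q.1, -q.2) = rad q := by simp only [rad, neg_sq]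
  by_cases hq : ε < rad q
  · rw [Set.indicator_of_mem (show q ∈ {q : ℝ × ℝ | ε < rad q} from hq),
      Set.indicator_of_mem (show (-q.1, q.2) ∈ {q : ℝ × ℝ | ε < rad q} from hq.trans_eq r1.symm),
      Set.indicator_of_mem (show (-q.1, -q.2) ∈ {q : ℝ × ℝ | ε < rad q} from hq.trans_eq r2.symm),
      Set.indicator_of_mem (show (q.1, -q.2) ∈ {q : ℝ × ℝ | ε < rad q} from hq.trans_eq r3.symm),
      Set.indicator_of_mem (show q ∈ {q : ℝ × ℝ | ε < rad q} from hq)]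
    simp only [pvIntegrand, symIntegrand, symDiff4, kernel, r1, r2, r3, Prod.add_def,
      ← sub_eq_add_neg]
    ring
  · rw [Set.indicator_of_notMem (show q ∉ {q : ℝ × ℝ | ε < rad q} from hq),
      Set.indicator_of_notMem (show (-q.1, q.2) ∉ {q : ℝ × ℝ | ε < rad q} from
        fun h => hq (h.trans_eq r1)),
      Set.indicator_of_notMem (show (-q.1, -q.2) ∉ {q : ℝ × ℝ | ε < rad q} from
        fun h => hq (h.trans_eq r2)),
      Set.indicator_of_notMem (show (q.1, -q.2) ∉ {q : ℝ × ℝ | ε < rad q} from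
        fun h => hq (h.trans_eq r3)),
      Set.indicator_of_notMem (show q ∉ {q : ℝ × ℝ | ε < rad q} from hq)]
    ring

theorem tendsto_setIntegral_lt_rad {f : ℝ × ℝ → ℝ} (hf : Integrable f) :
    Tendsto (fun ε : ℝ => ∫ q in {q : ℝ × ℝ | ε < rad q}, f q) (𝓝[>] 0) (𝓝 (∫ q, f q)) := by
  simp only [← integral_indicator (measurableSet_lt_rad _)]
  refine tendsto_integral_filter_of_dominated_convergence (fun q => ‖f q‖)
    (Eventually.of_forall fun ε => hf.aestronglyMeasurable.indicator (measurableSet_lt_rad ε))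
    (Eventually.of_forall fun ε => ae_of_all _ fun q => norm_indicator_le_norm_self _ _) hf.norm ?_
  have h0 : ∀ᵐ q : ℝ × ℝ, q ≠ 0 := by simp [ae_iff]
  filter_upwards [h0] with q hq
  refine tendsto_const_nhds.congr' ?_
  have : ∀ᶠ ε : ℝ in 𝓝[>] 0, ε < rad q :=
    mem_nhdsWithin_of_mem_nhds (Iio_mem_nhds (rad_pos hq))
  filter_upwards [this] with ε hε
  exact (Set.indicator_of_mem (show q ∈ {q : ℝ × ℝ | ε < rad q} from hε) f).symm

theorem tendsto_pvTrunc {u : ℝ × ℝ → ℝ} {M B : ℝ} (hc : Continuous u)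
    (hB : ∀ q, |u q| ≤ B) (hu : SecondPartialBdd u M)
    (hu' : SecondPartialBdd (u ∘ Prod.swap) M) {β lam : ℝ} (hβ : 0 < β) (hβ2 : β < 2)
    (hl : 0 ≤ lam) (p : ℝ × ℝ) :
    Tendsto (pvTrunc β lam u p) (𝓝[>] 0)
      (𝓝 (∫ q in Set.Ioi (0 : ℝ) ×ˢ Set.Ioi (0 : ℝ), symIntegrand β lam u p q)) := by
  have hi := integrable_symIntegrand hc hB hu hu' hβ hβ2 hl p
  have h1 := (tendsto_setIntegral_lt_rad hi).const_mul (1 / 4)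
  -- The four reflections and the four quadrants cancel, so the quadrant integral appears with
  -- factor one.
  rw [integral_eq_four_mul_quadrant hi (symIntegrand_even β lam u p), ← mul_assoc] at h1
  norm_num only [one_mul] at h1
  refine h1.congr' ?_
  filter_upwards [self_mem_nhdsWithin] with ε hε
  rw [← four_mul_pvTrunc hc hB hβ hl p hε]
  ring

/-! ### Splitting the quadrant into cells -/

/-- The half-open grid cell. -/
def halfCell (h : ℝ) (i j : ℕ) : Set (ℝ × ℝ) :=
  Set.Ioc (i * h) ((i + 1) * h) ×ˢ Set.Ioc (j * h) ((j + 1) * h)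

theorem measurableSet_halfCell (h : ℝ) (i j : ℕ) : MeasurableSet (halfCell h i j) :=
  measurableSet_Ioc.prod measurableSet_Ioc

theorem halfCell_subset_cell (h : ℝ) (i j : ℕ) : halfCell h i j ⊆ cell h i j :=
  Set.prod_mono Set.Ioc_subset_Icc_self Set.Ioc_subset_Icc_self

theorem setIntegral_cell_eq_halfCell (h : ℝ) (i j : ℕ) (f : ℝ × ℝ → ℝ) :
    ∫ q in cell h i j, f q = ∫ q in halfCell h i j, f q :=
  setIntegral_congr_set (Measure.set_prod_ae_eq Ioc_ae_eq_Icc Ioc_ae_eq_Icc).symm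

theorem eq_of_mem_Ioc_mul {h x : ℝ} (hh : 0 < h) {i i' : ℕ} (hi : x ∈ Set.Ioc (i * h) ((i + 1) * h))
    (hi' : x ∈ Set.Ioc (i' * h) ((i' + 1) * h)) : i = i' := by
  have h1 : (i : ℝ) < i' + 1 := lt_of_mul_lt_mul_right (hi.1.trans_le hi'.2) hh.le
  have h2 : (i' : ℝ) < i + 1 := lt_of_mul_lt_mul_right (hi'.1.trans_le hi.2) hh.le
  norm_cast at h1 h2
  omega

theorem pairwiseDisjoint_halfCell {h : ℝ} (hh : 0 < h) (s : Set (ℕ × ℕ)) :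
    s.PairwiseDisjoint fun ij => halfCell h ij.1 ij.2 := by
  intro a _ b _ hab
  refine Set.disjoint_left.2 fun q hq hq' => hab (Prod.ext ?_ ?_)
  · exact eq_of_mem_Ioc_mul hh hq.1 hq'.1
  · exact eq_of_mem_Ioc_mul hh hq.2 hq'.2

theorem exists_mem_Ioc_mul {h x : ℝ} {N : ℕ} (hx : x ∈ Set.Ioc 0 (N * h)) :
    ∃ i < N, x ∈ Set.Ioc (i * h) ((i + 1) * h) := by
  have := Ioc_subset_biUnion_Ioc N (fun n => (n : ℝ) * h)
  simp only [Nat.cast_zero, zero_mul] at this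
  obtain ⟨i, hi, hxi⟩ := Set.mem_iUnion₂.1 (this hx)
  refine ⟨i, by simpa using hi, by simpa using hxi⟩

theorem biUnion_halfCell {h : ℝ} (hh : 0 < h) (N : ℕ) :
    ⋃ ij ∈ Finset.range N ×ˢ Finset.range N, halfCell h ij.1 ij.2
      = Set.Ioc 0 (N * h) ×ˢ Set.Ioc 0 (N * h) := by
  have up : ∀ {i : ℕ} {x : ℝ}, i < N → x ∈ Set.Ioc (i * h) ((i + 1) * h) →
      x ∈ Set.Ioc 0 (N * h) := by
    intro i x hi hx
    have : (i : ℝ) + 1 ≤ N := by exact_mod_cast hi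
    exact ⟨lt_of_le_of_lt (by positivity) hx.1, hx.2.trans (by gcongr)⟩
  ext q
  simp only [Set.mem_iUnion₂, Finset.mem_product, Finset.mem_range]
  constructor
  · rintro ⟨ij, ⟨hi, hj⟩, h1, h2⟩
    exact ⟨up hi h1, up hj h2⟩
  · rintro ⟨h1, h2⟩
    obtain ⟨i, hi, hi'⟩ := exists_mem_Ioc_mul h1
    obtain ⟨j, hj, hj'⟩ := exists_mem_Ioc_mul h2
    exact ⟨(i, j), ⟨hi, hj⟩, hi', hj'⟩

theorem setIntegral_square_eq_sum {h : ℝ} (hh : 0 < h) {N : ℕ} (hN : 1 ≤ N) {f : ℝ × ℝ → ℝ}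
    (hf : Integrable f) :
    ∫ q in Set.Ioc 0 (N * h) ×ˢ Set.Ioc 0 (N * h), f q = (∫ q in halfCell h 0 0, f q)
      + ∑ ij ∈ (Finset.range N ×ˢ Finset.range N).erase (0, 0),
          ∫ q in halfCell h ij.1 ij.2, f q := by
  rw [← biUnion_halfCell hh, integral_biUnion_finset _ (fun _ _ => measurableSet_halfCell _ _ _)
    (pairwiseDisjoint_halfCell hh _) (fun _ _ => hf.integrableOn)]
  have hmem : ((0, 0) : ℕ × ℕ) ∈ Finset.range N ×ˢ Finset.range N := by
    simp only [Finset.mem_product, Finset.mem_range]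
    omega
  rw [← Finset.add_sum_erase _ _ hmem]

/-- The half-open cells are disjoint and, without the singular one, lie in `h < ‖q‖`; hence the
bound does not depend on how many there are. -/
theorem sum_setIntegral_norm_rpow_le {h s : ℝ} (hh : 0 < h) (hs : 2 < s)
    {S : Finset (ℕ × ℕ)} (hS : (0, 0) ∉ S) :
    ∑ ij ∈ S, ∫ q in halfCell h ij.1 ij.2, ‖q‖ ^ (-s)
      ≤ supBallConst * (h ^ (2 - s) / (s - 2)) := by
  have hsub : ∀ ij ∈ S, halfCell h ij.1 ij.2 ⊆ {q | h < ‖q‖} := by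
    rintro ⟨i, j⟩ hij q ⟨⟨h1, -⟩, ⟨h2, -⟩⟩
    have c1 : q.1 ≤ ‖q‖ := (le_abs_self _).trans (norm_fst_le q)
    have c2 : q.2 ≤ ‖q‖ := (le_abs_self _).trans (norm_snd_le q)
    simp only at h1 h2
    show h < ‖q‖
    rcases Nat.eq_zero_or_pos i with rfl | hi
    · rcases Nat.eq_zero_or_pos j with rfl | hj
      · exact absurd hij hS
      · have : (1 : ℝ) ≤ j := by exact_mod_cast hj
        nlinarith
    · have : (1 : ℝ) ≤ i := by exact_mod_cast hi
      nlinarith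
  obtain ⟨hi, he⟩ := integrableOn_norm_rpow_far hs hh
  rw [← integral_biUnion_finset S (fun _ _ => measurableSet_halfCell _ _ _)
    (pairwiseDisjoint_halfCell hh _) (fun ij h' => hi.mono_set (hsub ij h')), ← he]
  exact setIntegral_mono_set hi (ae_of_all _ fun q => Real.rpow_nonneg (norm_nonneg _) _)
    (LE.le.eventuallyLE (Set.iUnion₂_subset hsub))

theorem setIntegral_quadrant_eq {L : ℝ} (hL : 0 < L) {f : ℝ × ℝ → ℝ} (hf : Integrable f) :
    ∫ q in Set.Ioi (0 : ℝ) ×ˢ Set.Ioi (0 : ℝ), f q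
      = (∫ q in Set.Ioc 0 L ×ˢ Set.Ioc 0 L, f q) + ((∫ q in Set.Ioc 0 L ×ˢ Set.Ioi L, f q)
        + (∫ q in Set.Ioi L ×ˢ Set.Ioc 0 L, f q) + ∫ q in Set.Ioi L ×ˢ Set.Ioi L, f q) := by
  have hd : Disjoint (Set.Ioc 0 L) (Set.Ioi L) := Set.Ioc_disjoint_Ioi le_rfl
  have hu : Set.Ioi (0 : ℝ) = Set.Ioc 0 L ∪ Set.Ioi L := (Set.Ioc_union_Ioi_eq_Ioi hL.le).symm
  have i : ∀ s, IntegrableOn f s := fun s => hf.integrableOn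
  have h1 : ∀ s : Set ℝ, MeasurableSet s → ∫ q in s ×ˢ Set.Ioi (0 : ℝ), f q
      = (∫ q in s ×ˢ Set.Ioc 0 L, f q) + ∫ q in s ×ˢ Set.Ioi L, f q := by
    intro s hs
    rw [hu, Set.prod_union, setIntegral_union (Set.Disjoint.set_prod_right hd _ _)
      (hs.prod measurableSet_Ioi) (i _) (i _)]
  have h2 : ∫ q in Set.Ioi (0 : ℝ) ×ˢ Set.Ioi (0 : ℝ), f q
      = (∫ q in Set.Ioc 0 L ×ˢ Set.Ioi (0 : ℝ), f q) + ∫ q in Set.Ioi L ×ˢ Set.Ioi (0 : ℝ), f q := by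
    rw [← setIntegral_union (Set.Disjoint.set_prod_left hd _ _) (measurableSet_Ioi.prod measurableSet_Ioi)
      (i _) (i _), ← Set.union_prod, ← hu]
  rw [h2, h1 _ measurableSet_Ioc, h1 _ measurableSet_Ioi]
  ring

/-! ### Truncation error -/

/-- The splitting parameter `γ` cancels, so the exact integrand can be compared with the quadrature
for any `γ`. -/
theorem phi_mul_weight (β γ lam : ℝ) (u : ℝ × ℝ → ℝ) (p : ℝ × ℝ) {q : ℝ × ℝ} (hq : 0 < rad q) :
    phi γ lam u p q.1 q.2 * weight β γ q = symIntegrand β lam u p q := by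
  rw [phi_eq, weight_eq, symIntegrand, kernel_eq]
  unfold temperedPow
  simp only [Prod.mk.eta]
  rw [mul_assoc, mul_assoc, ← Real.rpow_add hq]
  congr 3
  ring

theorem abs_setIntegral_singularCell_le {u : ℝ × ℝ → ℝ} {M : ℝ} (hu : SecondPartialBdd u M)
    (hu' : SecondPartialBdd (u ∘ Prod.swap) M) {β lam h : ℝ} (hβ : 0 < β) (hβ2 : β < 2)
    (hl : 0 ≤ lam) (hh : 0 < h) (p : ℝ × ℝ) :
    |∫ q in halfCell h 0 0, symIntegrand β lam u p q|
      ≤ 4 * M * (supBallConst * (h ^ (2 - β) / (2 - β))) := by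
  have hM0 := hu.nonneg
  obtain ⟨hi, he⟩ := integrableOn_norm_rpow_near hβ2 hh
  have hsub : halfCell h 0 0 ⊆ {q | ‖q‖ ≤ h} := fun q hq => by
    simpa using cell_subset_norm_le hh 0 0 (halfCell_subset_cell h 0 0 hq)
  have hi2 : IntegrableOn (fun q : ℝ × ℝ => 4 * M * ‖q‖ ^ (-β)) {q | ‖q‖ ≤ h} :=
    hi.const_mul (4 * M)
  rw [← he, ← integral_const_mul, ← Real.norm_eq_abs]
  refine (norm_integral_le_of_norm_le (hi2.mono_set hsub)
    (ae_of_all _ fun q => abs_symIntegrand_le hu hu' hβ hl p q)).trans ?_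
  exact setIntegral_mono_set hi2 (ae_of_all _ fun q => by positivity)
    (LE.le.eventuallyLE hsub)

theorem Gzero_nonneg (β γ h : ℝ) : 0 ≤ Gzero β γ h :=
  integral_nonneg fun q => by
    rw [weight_eq]; exact Real.rpow_nonneg (rad_nonneg q) _

theorem Gzero_le {β γ h : ℝ} (hβ : 0 < β) (hβγ : β < γ) (hγ2 : γ ≤ 2) (hh : 0 < h) :
    Gzero β γ h ≤ supBallConst * (h ^ (γ - β) / (γ - β)) := by
  obtain ⟨hi, he⟩ := integrableOn_norm_rpow_near (s := 2 + β - γ) (by linarith) hh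
  have hsub : cell h 0 0 ⊆ {q | ‖q‖ ≤ h} := fun q hq => by
    simpa using cell_subset_norm_le hh 0 0 hq
  rw [show 2 - (2 + β - γ) = γ - β by ring] at he
  rw [← he]
  calc Gzero β γ h ≤ ∫ q in cell h 0 0, ‖q‖ ^ (-(2 + β - γ)) :=
        integral_mono (integrableOn_weight_cell hβ hβγ hγ2 hh 0 0) (hi.mono_set hsub) fun q => by
          rw [weight_eq]; exact rad_rpow_neg_le (by linarith) q
    _ ≤ _ := setIntegral_mono_set hi
        (ae_of_all _ fun q => Real.rpow_nonneg (norm_nonneg _) _) (LE.le.eventuallyLE hsub)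

theorem abs_phi_le {u : ℝ × ℝ → ℝ} {M : ℝ} (hu : SecondPartialBdd u M)
    (hu' : SecondPartialBdd (u ∘ Prod.swap) M) {γ lam h : ℝ} (hγ0 : 0 ≤ γ) (hγ2 : γ ≤ 2)
    (hl : 0 ≤ lam) (p : ℝ × ℝ) {ξ η : ℝ} (h0 : 0 < rad (ξ, η))
    (h2 : rad (ξ, η) ≤ 2 * h) : |phi γ lam u p ξ η| ≤ 16 * M * h ^ (2 - γ) := by
  have hM0 := hu.nonneg
  have hh : 0 < h := by linarith
  rw [phi_eq, abs_mul, abs_of_nonneg (temperedPow_nonneg lam γ h0.le)]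
  calc _ ≤ 4 * M * rad (ξ, η) ^ 2 * rad (ξ, η) ^ (-γ) :=
        mul_le_mul (abs_symDiff4_le hu hu' p ξ η) (temperedPow_le γ hl h0.le)
          (temperedPow_nonneg lam γ h0.le) (by positivity)
    _ = 4 * M * rad (ξ, η) ^ (2 - γ) := by
        rw [mul_assoc, ← Real.rpow_natCast, ← Real.rpow_add h0, Nat.cast_ofNat, ← sub_eq_add_neg]
    _ ≤ 4 * M * (2 * h) ^ (2 - γ) := by
        have : 0 ≤ 2 - γ := by linarith
        gcongr
    _ = 4 * M * (2 ^ (2 - γ) * h ^ (2 - γ)) := by rw [Real.mul_rpow (by norm_num) hh.le]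
    _ ≤ 4 * M * (4 * h ^ (2 - γ)) := by
        gcongr
        calc (2 : ℝ) ^ (2 - γ) ≤ 2 ^ (2 : ℝ) :=
              Real.rpow_le_rpow_of_exponent_le (by norm_num) (by linarith)
          _ = 4 := by norm_num
    _ = _ := by ring

/-- Each corner value is `O(h^(2-γ))` and `G_{0,0}` is `O(h^(γ-β))`. The factor `k_γ` matters only
through `k_γ / 4 ≤ 1/3`. -/
theorem abs_singularCell_le {u : ℝ × ℝ → ℝ} {M : ℝ} (hu : SecondPartialBdd u M)
    (hu' : SecondPartialBdd (u ∘ Prod.swap) M) {β γ lam h : ℝ} (hβ : 0 < β) (hβγ : β < γ)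
    (hγ2 : γ ≤ 2) (hl : 0 ≤ lam) (hh : 0 < h) (p : ℝ × ℝ) :
    |singularCell β γ h (phi γ lam u p)|
      ≤ 16 * M * (supBallConst * (h ^ (2 - β) / (γ - β))) := by
  have hM0 := hu.nonneg
  have hγ0 : 0 ≤ γ := by linarith
  have key : ∀ q : ℝ × ℝ, q ≠ 0 → ‖q‖ ≤ h → |phi γ lam u p q.1 q.2| ≤ 16 * M * h ^ (2 - γ) :=
    fun q hq hqh => abs_phi_le hu hu' hγ0 hγ2 hl p (rad_pos hq)
      ((rad_le_two_mul_norm q).trans (by linarith))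
  have k1 := key (0, h) (by simp [hh.ne']) (by simp [Prod.norm_def, abs_of_pos hh, hh.le])
  have k2 := key (h, h) (by simp [hh.ne']) (by simp [Prod.norm_def, abs_of_pos hh])
  have k3 := key (h, 0) (by simp [hh.ne']) (by simp [Prod.norm_def, abs_of_pos hh, hh.le])
  simp only at k1 k2 k3
  have hk : 0 ≤ kGamma γ / 4 ∧ kGamma γ / 4 ≤ 1 / 3 := by
    unfold kGamma
    split_ifs <;> norm_num
  have hsum : |phi γ lam u p 0 h + phi γ lam u p h h + phi γ lam u p h 0|
      ≤ 48 * M * h ^ (2 - γ) := by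
    rw [abs_le] at *
    exact ⟨by linarith [k1.1, k2.1, k3.1], by linarith [k1.2, k2.2, k3.2]⟩
  have e : h ^ (2 - β) = h ^ (2 - γ) * h ^ (γ - β) := by
    rw [← Real.rpow_add hh]; ring_nf
  unfold singularCell
  rw [abs_mul, abs_mul, abs_of_nonneg hk.1, abs_of_nonneg (Gzero_nonneg β γ h)]
  calc _ ≤ 1 / 3 * (48 * M * h ^ (2 - γ)) * (supBallConst * (h ^ (γ - β) / (γ - β))) := by
        have := Gzero_le hβ hβγ hγ2 hh
        have := Gzero_nonneg β γ h
        have := hk.2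
        gcongr
    _ = _ := by rw [e]; ring

theorem abs_setIntegral_sub_interpCell_le {u : ℝ × ℝ → ℝ} {M : ℝ} (hu : SecondPartialBdd u M)
    (hu' : SecondPartialBdd (u ∘ Prod.swap) M) {β γ lam h : ℝ} (hβ : 0 < β) (hβγ : β < γ)
    (hγ2 : γ ≤ 2) (hl : 0 ≤ lam) (hh : 0 < h) (p : ℝ × ℝ)
    (hint : Integrable (symIntegrand β lam u p)) {i j : ℕ} (hij : (i, j) ≠ (0, 0)) :
    |(∫ q in halfCell h i j, symIntegrand β lam u p q) - interpCell β γ h (phi γ lam u p) i j|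
      ≤ 1800 * M * h ^ 2 * ∫ q in halfCell h i j, ‖q‖ ^ (-(2 + β)) := by
  have hM0 := hu.nonneg
  have hpos : ∀ q ∈ cell h i j, h ≤ rad q := fun q hq => (rad_le_three_mul_rad hh hij hq hq).1
  -- The comparison `rad q ≤ 2 * ‖q‖` gives `h / 2 ≤ ‖q‖`; `h / 3` makes the inequality strict. This
  -- serves integrability only.
  have hcell : cell h i j ⊆ {q | h / 3 < ‖q‖} := fun q hq => by
    have h1 := rad_le_two_mul_norm q
    have h2 := hpos q hq
    show h / 3 < ‖q‖
    linarith
  rw [interpCell_eq_integral hβ hβγ hγ2 hh, ← setIntegral_cell_eq_halfCell,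
    ← setIntegral_cell_eq_halfCell, ← integral_const_mul, ← integral_sub hint.integrableOn
      (integrableOn_mul_weight_cell hβ hβγ hγ2 hh i j (continuous_bilin _ _ _ _)), ← Real.norm_eq_abs]
  have hi : IntegrableOn (fun q : ℝ × ℝ => ‖q‖ ^ (-(2 + β))) (cell h i j) :=
    (integrableOn_norm_rpow_far (by linarith) (by positivity)).1.mono_set hcell
  refine norm_integral_le_of_norm_le (hi.const_mul _) ?_
  filter_upwards [ae_restrict_mem (isCompact_cell h i j).measurableSet] with q hq
  have hr : 0 < rad q := hh.trans_le (hpos q hq)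
  have h1 := abs_phi_sub_bilin_le hu hu' hl (hβ.trans hβγ).le hγ2 hh p hij hq
  rw [← phi_mul_weight β γ lam u p hr, ← sub_mul, Real.norm_eq_abs, abs_mul, weight_eq,
    abs_of_nonneg (Real.rpow_nonneg hr.le _)]
  calc _ ≤ 1800 * M * h ^ 2 * rad q ^ (-γ) * rad q ^ (-(2 + β - γ)) := by gcongr
    _ = 1800 * M * h ^ 2 * rad q ^ (-(2 + β)) := by
        rw [mul_assoc, ← Real.rpow_add hr]; congr 2; ring
    _ ≤ _ := mul_le_mul_of_nonneg_left (rad_rpow_neg_le (by linarith) q) (by positivity)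

/-- A shift by more than the side `2 * l`, in either direction, takes a point of the square out of
it. -/
theorem symDiff4_eq_of_lt {u : ℝ × ℝ → ℝ} {l : ℝ} (hs : Function.support u ⊆ square l)
    {p : ℝ × ℝ} (hp : p ∈ square l) {ξ η : ℝ} (h : 2 * l < ξ ∨ 2 * l < η) :
    symDiff4 u p ξ η = -4 * u p := by
  obtain ⟨⟨a1, a2⟩, ⟨a3, a4⟩⟩ := hp
  have z : ∀ x y : ℝ, (x ≤ -l ∨ l ≤ x ∨ y ≤ -l ∨ l ≤ y) → u (x, y) = 0 := by
    intro x y hxy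
    by_contra hne
    obtain ⟨⟨b1, b2⟩, ⟨b3, b4⟩⟩ := hs hne
    simp only at b1 b2 b3 b4
    rcases hxy with h | h | h | h <;> linarith
  unfold symDiff4
  rcases h with h | h
  · rw [z _ _ (Or.inr (Or.inl (by linarith))), z _ _ (Or.inl (by linarith)),
      z _ _ (Or.inl (by linarith)), z _ _ (Or.inr (Or.inl (by linarith)))]
    ring
  · rw [z _ _ (Or.inr (Or.inr (Or.inr (by linarith)))),
      z _ _ (Or.inr (Or.inr (Or.inr (by linarith)))),
      z _ _ (Or.inr (Or.inr (Or.inl (by linarith)))),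
      z _ _ (Or.inr (Or.inr (Or.inl (by linarith))))]
    ring

theorem setIntegral_outer_eq {u : ℝ × ℝ → ℝ} {l : ℝ} (hs : Function.support u ⊆ square l)
    {p : ℝ × ℝ} (hp : p ∈ square l) (β lam : ℝ) :
    (∫ q in Set.Ioc 0 (2 * l) ×ˢ Set.Ioi (2 * l), symIntegrand β lam u p q)
      + (∫ q in Set.Ioi (2 * l) ×ˢ Set.Ioc 0 (2 * l), symIntegrand β lam u p q)
      + ∫ q in Set.Ioi (2 * l) ×ˢ Set.Ioi (2 * l), symIntegrand β lam u p q
      = -(4 * u p * Ginf β lam (2 * l)) := by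
  have key : ∀ S : Set (ℝ × ℝ), MeasurableSet S → (∀ q ∈ S, 2 * l < q.1 ∨ 2 * l < q.2) →
      ∫ q in S, symIntegrand β lam u p q = -4 * u p * ∫ q in S, kernel β lam q := by
    intro S hS h
    rw [← integral_const_mul]
    refine setIntegral_congr_fun hS fun q hq => ?_
    simp only [symIntegrand, symDiff4_eq_of_lt hs hp (h q hq)]
  rw [key _ (measurableSet_Ioc.prod measurableSet_Ioi) fun q hq => Or.inr hq.2,
    key _ (measurableSet_Ioi.prod measurableSet_Ioc) fun q hq => Or.inl hq.1,
    key _ (measurableSet_Ioi.prod measurableSet_Ioi) fun q hq => Or.inl hq.1, Ginf]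
  ring

/-- The truncation error of the discrete operator, with an explicit constant. -/
theorem abs_temperedFracLap_sub_discreteTFL_le {u : ℝ × ℝ → ℝ} {M B : ℝ} (hc : Continuous u)
    (hB : ∀ q, |u q| ≤ B) (hu : SecondPartialBdd u M) (hu' : SecondPartialBdd (u ∘ Prod.swap) M)
    {β γ lam l : ℝ} (hβ : 0 < β) (hβ2 : β < 2) (hβγ : β < γ) (hγ2 : γ ≤ 2) (hl : 0 ≤ lam)
    (hl0 : 0 < l) (hs : Function.support u ⊆ square l) {N : ℕ} (hN : 1 ≤ N) {p : ℝ × ℝ}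
    (hp : p ∈ square l) :
    |temperedFracLap β lam u p - discreteTFL β γ lam l N u p| ≤ |normConst β lam| *
      (M * supBallConst * (4 / (2 - β) + 16 / (γ - β) + 1800 / β)) * (2 * l / N) ^ (2 - β) := by
  have hM0 := hu.nonneg
  have hN0 : (0 : ℝ) < N := by exact_mod_cast hN
  set h : ℝ := 2 * l / N with hdef
  have hh : 0 < h := by positivity
  have hNh : (N : ℝ) * h = 2 * l := by rw [hdef]; field_simp
  have hint := integrable_symIntegrand hc hB hu hu' hβ hβ2 hl p
  have hlim := (tendsto_pvTrunc hc hB hu hu' hβ hβ2 hl p).limUnder_eq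
  have hsq := setIntegral_square_eq_sum hh hN hint
  rw [hNh] at hsq
  set S := (Finset.range N ×ˢ Finset.range N).erase (0, 0) with hS
  -- The exterior contributions cancel exactly, leaving the singular cell and the sum of
  -- interpolation errors.
  have e : temperedFracLap β lam u p - discreteTFL β γ lam l N u p = normConst β lam *
      ((∫ q in halfCell h 0 0, symIntegrand β lam u p q)
        - singularCell β γ h (phi γ lam u p)
        + ∑ ij ∈ S, ((∫ q in halfCell h ij.1 ij.2, symIntegrand β lam u p q)
          - interpCell β γ h (phi γ lam u p) ij.1 ij.2)) := by
    rw [temperedFracLap, discreteTFL, hlim, setIntegral_quadrant_eq (L := 2 * l) (by positivity) hint,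
      setIntegral_outer_eq hs hp, hsq, Finset.sum_sub_distrib, ← hS, ← hdef]
    ring
  have b1 := abs_setIntegral_singularCell_le hu hu' hβ hβ2 hl hh p
  have b2 := abs_singularCell_le hu hu' hβ hβγ hγ2 hl hh p
  have b3 : |∑ ij ∈ S, ((∫ q in halfCell h ij.1 ij.2, symIntegrand β lam u p q)
      - interpCell β γ h (phi γ lam u p) ij.1 ij.2)|
      ≤ 1800 * M * (supBallConst * (h ^ (2 - β) / β)) := by
    refine (Finset.abs_sum_le_sum_abs _ _).trans ((Finset.sum_le_sum fun ij hij =>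
      abs_setIntegral_sub_interpCell_le hu hu' hβ hβγ hγ2 hl hh p hint
        (Finset.ne_of_mem_erase hij)).trans ?_)
    rw [← Finset.mul_sum]
    have h1 := sum_setIntegral_norm_rpow_le (s := 2 + β) hh (by linarith)
      (Finset.notMem_erase (0, 0) (Finset.range N ×ˢ Finset.range N))
    have e2 : h ^ (2 - β) = h ^ 2 * h ^ (-β) := by
      rw [← Real.rpow_natCast, ← Real.rpow_add hh, Nat.cast_ofNat, ← sub_eq_add_neg]
    rw [show 2 - (2 + β) = -β by ring, show 2 + β - 2 = β by ring] at h1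
    calc _ ≤ 1800 * M * h ^ 2 * (supBallConst * (h ^ (-β) / β)) := by gcongr
      _ = _ := by rw [e2]; ring
  rw [e, abs_mul, mul_assoc]
  refine mul_le_mul_of_nonneg_left ?_ (abs_nonneg _)
  calc _ ≤ 4 * M * (supBallConst * (h ^ (2 - β) / (2 - β)))
        + 16 * M * (supBallConst * (h ^ (2 - β) / (γ - β)))
        + 1800 * M * (supBallConst * (h ^ (2 - β) / β)) :=
        (abs_add_le _ _).trans (add_le_add ((abs_sub _ _).trans (add_le_add b1 b2)) b3)
    _ = _ := by ring

/-- For fixed `β` the constant takes at most two values as `lam` varies, attained at `0` and `1`. -/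
theorem abs_normConst_le (β lam : ℝ) :
    |normConst β lam| ≤ |normConst β 0| + |normConst β 1| := by
  by_cases h : lam = 0 ∨ β = 1
  · have : normConst β lam = normConst β 0 := by simp [normConst, h]
    rw [this]
    exact le_add_of_nonneg_right (abs_nonneg _)
  · have h' := not_or.1 h
    have : normConst β lam = normConst β 1 := by simp [normConst, h'.1, h'.2]
    rw [this]
    exact le_add_of_nonneg_left (abs_nonneg _)

theorem hasCompactSupport_of_support_subset_square {u : ℝ × ℝ → ℝ} {l : ℝ}
    (hs : Function.support u ⊆ square l) : HasCompactSupport u :=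
  HasCompactSupport.of_support_subset_isCompact (isCompact_Icc.prod isCompact_Icc)
    (hs.trans (Set.prod_mono Set.Ioo_subset_Icc_self Set.Ioo_subset_Icc_self))

end TemperedFrac

end

theorem mainTheorem2 (β γ : ℝ) (hβ0 : 0 < β) (hβ2 : β < 2) (hβγ : β < γ) (hγ2 : γ ≤ 2)
    (u : ℝ × ℝ → ℝ) (hu : ContDiff ℝ 2 u) :
    ∃ C : ℝ, 0 < C ∧
      ∀ l : ℝ, 0 < l → Function.support u ⊆ TemperedFrac.square l →
      ∀ lam : ℝ, 0 ≤ lam →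
        (∀ p ∈ TemperedFrac.square l, TemperedFrac.PVExists β lam u p) ∧
        ∀ N : ℕ, 1 ≤ N → ∀ p ∈ TemperedFrac.square l,
          |TemperedFrac.temperedFracLap β lam u p - TemperedFrac.discreteTFL β γ lam l N u p|
            ≤ C * (2 * l / (N : ℝ)) ^ (2 - β) := by
  open TemperedFrac in
  -- If no square contains the support, the claim is vacuous. Otherwise `l₀` serves only to make the
  -- support compact, so that the bounds `M` and `B` depend on `u` and not on the later `l`.
  by_cases hsupp : ∃ l, Function.support u ⊆ square l
  swap
  · exact ⟨1, one_pos, fun l _ hs => absurd ⟨l, hs⟩ hsupp⟩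
  obtain ⟨l₀, hl₀⟩ := hsupp
  have hcs := hasCompactSupport_of_support_subset_square hl₀
  have hcs' : HasCompactSupport (u ∘ Prod.swap) :=
    hcs.comp_homeomorph (Homeomorph.prodComm ℝ ℝ)
  obtain ⟨M₁, hM₁⟩ := exists_secondPartialBdd hu hcs
  obtain ⟨M₂, hM₂⟩ := exists_secondPartialBdd (hu.comp (contDiff_snd.prodMk contDiff_fst)) hcs'
  obtain ⟨B, hB⟩ := hu.continuous.bounded_above_of_compact_support hcs
  have h1 := hM₁.mono (le_max_left M₁ M₂)
  have h2 : SecondPartialBdd (u ∘ Prod.swap) _ := SecondPartialBdd.mono hM₂ (le_max_right M₁ M₂)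
  set M := max M₁ M₂
  set K := M * supBallConst * (4 / (2 - β) + 16 / (γ - β) + 1800 / β)
  have hK : 0 ≤ K := by
    have := h1.nonneg
    have := supBallConst_nonneg
    have a1 : 0 < 2 - β := by linarith
    have a2 : 0 < γ - β := by linarith
    positivity
  -- The added `1` makes the constant positive even when `K = 0`.
  refine ⟨(|normConst β 0| + |normConst β 1|) * K + 1, by positivity,
    fun l hl hs lam hlam => ⟨fun p _ => ⟨fun ε hε =>
      integrableOn_pvIntegrand hu.continuous hB hβ0 hlam p hε,
      _, tendsto_pvTrunc hu.continuous hB h1 h2 hβ0 hβ2 hlam p⟩, fun N hN p hp => ?_⟩⟩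
  have := abs_temperedFracLap_sub_discreteTFL_le hu.continuous hB h1 h2 hβ0 hβ2 hβγ hγ2 hlam hl hs
    hN hp
  refine this.trans (mul_le_mul_of_nonneg_right ?_ (by positivity))
  have := mul_le_mul_of_nonneg_right (abs_normConst_le β lam) hK
  linarith
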